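/- Let $\gamma$ be a random variable with values in $[0,\infty]$ on a probability space $(\Omega,\mathscr F,\mathsf P)$ with $\mathsf P(\gamma>0)>0$. For $t\in[0,\infty)$ let $\mathscr F_t$ be the $\sigma$-field of all $A\in\mathscr F$ such that $A\cap\{t<\gamma\}$ is either $\varnothing$ or $\{t<\gamma\}$; the filtration $(\mathscr F_t)$ is not completed, and adaptedness, stopping times and (local) martingales refer to it. A local martingale is an adapted process $M$ with almost all paths càdlàg for which there are stopping times $T_n$ with $T_n\uparrow\infty$ a.s. such that each stopped process $(M_{t\wedge T_n})_{t\ge 0}$ is a uniformly integrable martingale. Put $G(t)=\mathsf P(\gamma\le t)$ and $\overline G(t)=1-G(t)$ for $t\in[0,\infty)$, let $dG$ be the restriction of the law of $\gamma$ to $[0,\infty)$, and put $t_G=\sup\{t\in[0,\infty): G(t)<1\}$ and $\mathcal T=\{t\in[0,\infty):\mathsf P(\gamma\ge t)>0\}$. Case B means that $t_G<\infty$ and $\mathsf P(\gamma=t_G)>0$. Let $L^1_{\mathrm{loc}}(dG)$ be the set of Borel functions $z\colon\mathcal T\to\mathbb R$ with $\int_{[0,t]}|z|\,dG<\infty$ for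 all $t\in\mathcal T$. A pair $(F,H)$ of functions $F\colon[0,t_G)\to\mathbb R$, $H\colon\mathcal T\to\mathbb R$ satisfies Condition M if 1. there is $z\in L^1_{\mathrm{loc}}(dG)$ such that $F(t)=F(0)+\int_{(0,t]}z\,dG$ for all $t<t_G$; 2. $H\in L^1_{\mathrm{loc}}(dG)$; 3. $F(t)\overline G(t)+\int_{(0,t]}H\,dG=F(0)\overline G(0)$ for all $t<t_G$; 4. in Case B, additionally $\lim_{t\uparrow t_G,\,t<t_G}F(t)=H(t_G)$. Theorem. Let $M=(M_t)_{t\in[0,\infty)}$ be an adapted process with almost all paths right-continuous. Then $M$ is a local martingale if and only if there are a pair $(F,H)$ satisfying Condition M and a real-valued random variable $L'$ with $$\mathsf E\bigl(|L'|\mathbf 1_{\{\gamma\le t\}}\bigr)<\infty\ \text{ for all } t\in\mathcal T,\qquad \mathsf E[L'\mid\gamma]=0,$$ such that, up to indistinguishability, $$M_t=F(t)\mathbf 1_{\{t<\gamma\}}+\bigl(H(\gamma)+L'\bigr)\mathbf 1_{\{t\ge\gamma\}},\qquad t\in[0,\infty).$$ Here $F$ outside $[0,t_G)$ and $H$ outside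 $\mathcal T$ may be given arbitrary real values, as these affect the right-hand side only on a null set. Since $L'$ need not be integrable, $\mathsf E[L'\mid\gamma]=0$ is understood in the generalized sense: there are sets $A_n\in\sigma(\gamma)$ increasing to $\Omega$ such that $L'\mathbf 1_{A_n}$ is integrable and $\mathsf E[L'\mathbf 1_{A_n}\mid\gamma]=0$ a.s. for every $n$. -/

import Mathlib

open MeasureTheory ProbabilityTheory Filter Topology Set
open scoped NNReal ENNReal

namespace SingleJump

/-! ### The law of the jump time -/

/-- The measure `dG` on `[0, ∞)`: the restriction to `[0, ∞)` of a law `ν` on `[0, ∞]`, that is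
the Lebesgue-Stieltjes measure of `G`, with an atom of mass `G 0` at `0`. -/
noncomputable def dG (ν : Measure ℝ≥0∞) : Measure ℝ≥0 :=
  ν.comap (fun t : ℝ≥0 => (t : ℝ≥0∞))

/-- The distribution function `G t = ν [0, t]`, for `t` in `[0, ∞)`. -/
noncomputable def G (ν : Measure ℝ≥0∞) (t : ℝ≥0) : ℝ := ν.real (Iic (t : ℝ≥0∞))

/-- The survival function `1 - G`. -/
noncomputable def Gbar (ν : Measure ℝ≥0∞) (t : ℝ≥0) : ℝ := 1 - G ν t

/-- The right endpoint `t_G = sup {t ∈ [0, ∞) : G t < 1}`, an element of `[0, ∞]`. -/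
noncomputable def tG (ν : Measure ℝ≥0∞) : ℝ≥0∞ :=
  sSup {x : ℝ≥0∞ | ∃ t : ℝ≥0, G ν t < 1 ∧ x = t}

/-- The time set `𝒯 = {t ∈ [0, ∞) : ν [t, ∞] > 0}`. -/
def timeSet (ν : Measure ℝ≥0∞) : Set ℝ≥0 := {t | 0 < ν (Ici (t : ℝ≥0∞))}

/-- Case B: the right endpoint is finite and is an atom of the law. -/
def CaseB (ν : Measure ℝ≥0∞) : Prop := tG ν < ∞ ∧ 0 < ν {tG ν}

/-! ### Condition M -/

/-- `z ∈ L¹_loc(dG)`: `z` is a Borel function on the time set `𝒯` which is `dG`-integrable over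
`[0, t]` for every `t ∈ 𝒯`. The values of `z` outside `𝒯` play no role. -/
def MemL1loc (ν : Measure ℝ≥0∞) (z : ℝ≥0 → ℝ) : Prop :=
  Measurable ((timeSet ν).domRestrict z) ∧ ∀ t ∈ timeSet ν, IntegrableOn z (Icc 0 t) (dG ν)

/-- Local absolute continuity with respect to `G` of a function `Z` on `[0, t_G)`. The values of
`Z` outside `[0, t_G)` play no role. -/
def LocallyAC (ν : Measure ℝ≥0∞) (Z : ℝ≥0 → ℝ) : Prop :=
  ∃ z : ℝ≥0 → ℝ, MemL1loc ν z ∧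
    ∀ t : ℝ≥0, (t : ℝ≥0∞) < tG ν → Z t = Z 0 + ∫ s in Ioc 0 t, z s ∂(dG ν)

/-- Condition M for a pair `(F, H)`, with `F` a function on `[0, t_G)` and `H` a function on `𝒯`
(only the values there play a role). -/
structure ConditionM (ν : Measure ℝ≥0∞) (F H : ℝ≥0 → ℝ) : Prop where
  locallyAC : LocallyAC ν F
  memL1loc : MemL1loc ν H
  main : ∀ t : ℝ≥0, (t : ℝ≥0∞) < tG ν →
    F t * Gbar ν t + ∫ s in Ioc 0 t, H s ∂(dG ν) = F 0 * Gbar ν 0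
  caseB : CaseB ν → Tendsto F (𝓝[<] (tG ν).toNNReal) (𝓝 (H (tG ν).toNNReal))

/-! ### The single jump filtration and its local martingales -/

variable {Ω : Type*} [mΩ : MeasurableSpace Ω]

/-- The single jump filtration generated by `γ` and the ambient `σ`-field: `A` belongs to the
`σ`-field at time `t` if `A` is an event and `A ∩ {t < γ}` is either empty or `{t < γ}`. -/
def filtration (γ : Ω → ℝ≥0∞) : Filtration ℝ≥0 mΩ where
  seq t :=
    { MeasurableSet' := fun A => MeasurableSet A ∧
        (A ∩ {ω | (t : ℝ≥0∞) < γ ω} = ∅ ∨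
          A ∩ {ω | (t : ℝ≥0∞) < γ ω} = {ω | (t : ℝ≥0∞) < γ ω})
      measurableSet_empty := ⟨MeasurableSet.empty, Or.inl (empty_inter _)⟩
      measurableSet_compl := by
        rintro A ⟨hA, h⟩
        refine ⟨hA.compl, ?_⟩
        rcases h with h | h
        · right
          ext ω
          have := Set.ext_iff.1 h ω
          simp only [mem_inter_iff, mem_compl_iff, mem_empty_iff_false, iff_false] at this ⊢
          tauto
        · left
          ext ω
          have := Set.ext_iff.1 h ω
          simp only [mem_inter_iff, mem_compl_iff, mem_empty_iff_false, iff_false] at this ⊢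
          tauto
      measurableSet_iUnion := by
        intro f hf
        refine ⟨MeasurableSet.iUnion fun i => (hf i).1, ?_⟩
        by_cases h : ∀ i, f i ∩ {ω | (t : ℝ≥0∞) < γ ω} = ∅
        · left
          rw [iUnion_inter]
          exact iUnion_eq_empty.2 h
        · right
          push Not at h
          obtain ⟨i, hi⟩ := h
          refine Subset.antisymm inter_subset_right fun ω hω => ⟨?_, hω⟩
          rcases (hf i).2 with h0 | h1
          · exact absurd h0 hi.ne_empty
          · exact mem_iUnion.2 ⟨i, (h1.symm ▸ hω : ω ∈ f i ∩ {ω | (t : ℝ≥0∞) < γ ω}).1⟩ }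
  mono' := by
    rintro s t hst A ⟨hA, h⟩
    refine ⟨hA, ?_⟩
    have hsub : {ω | (t : ℝ≥0∞) < γ ω} ⊆ {ω | (s : ℝ≥0∞) < γ ω} := fun ω hω =>
      lt_of_le_of_lt (ENNReal.coe_le_coe.2 hst) hω
    rcases h with h | h
    · left
      exact subset_empty_iff.1 (h ▸ inter_subset_inter_right A hsub)
    · right
      refine inter_eq_right.2 (hsub.trans ?_)
      exact inter_eq_right.1 h
  le' := fun _ _ hA => hA.1

/-- Càdlàg paths on `[0, ∞)`: right-continuous everywhere, with finite left-hand limits at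
positive times. -/
def IsCadlag (f : ℝ≥0 → ℝ) : Prop :=
  (∀ t, ContinuousWithinAt f (Ici t) t) ∧ ∀ t, 0 < t → ∃ l : ℝ, Tendsto f (𝓝[<] t) (𝓝 l)

/-- Local martingales: adapted processes with almost all paths càdlàg for which some sequence of
stopping times increasing to infinity almost surely makes every stopped process a uniformly
integrable martingale. The value at time `0` is not removed, so it is integrable. -/
structure IsLocalMartingale (M : ℝ≥0 → Ω → ℝ) (ℱ : Filtration ℝ≥0 mΩ) (P : Measure Ω) :
    Prop where
  adapted : Adapted ℱ M
  cadlag : ∀ᵐ ω ∂P, IsCadlag (fun t => M t ω)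
  localizing : ∃ τ : ℕ → Ω → WithTop ℝ≥0, IsLocalizingSequence ℱ τ P ∧
    ∀ n, Martingale (stoppedProcess M (τ n)) ℱ P ∧ UniformIntegrable (stoppedProcess M (τ n)) 1 P

/-- `Y` is a version of the conditional expectation `E[X | m]`, where `X` need not be integrable
but only `σ`-integrable with respect to `m`: the space is an increasing union of events of `m` on
each of which `X` is integrable. -/
def HasCondExp (P : Measure Ω) (m : MeasurableSpace Ω) (X Y : Ω → ℝ) : Prop :=
  ∃ A : ℕ → Set Ω, (∀ n, MeasurableSet[m] (A n)) ∧ Monotone A ∧ (⋃ n, A n) = univ ∧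
    ∀ n, IntegrableOn X (A n) P ∧ P[(A n).indicator X | m] =ᵐ[P] (A n).indicator Y

/-- The process `F(t) 1_{t < γ} + L 1_{t ≥ γ}`. -/
noncomputable def jumpProcess (γ : Ω → ℝ≥0∞) (F : ℝ≥0 → ℝ) (L : Ω → ℝ) (t : ℝ≥0) (ω : Ω) : ℝ :=
  {ω' | (t : ℝ≥0∞) < γ ω'}.indicator (fun _ => F t) ω +
    {ω' | γ ω' ≤ (t : ℝ≥0∞)}.indicator L ω

end SingleJump

namespace SingleJump

/-! ### Stieltjes calculus on `[0, t]` -/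

section Stieltjes

variable {μ : Measure ℝ≥0} {f : ℝ≥0 → ℝ} {t u : ℝ≥0}

/-! On `{t < γ}` the σ-field at time `t` is trivial, so an adapted process is deterministic there
(`eq_of_adapted`); on `{γ ≤ t}` it contains every event, so a martingale cannot move after `γ`
(`ae_eq_of_le_of_martingale`). Hence `M` equals some `F` before the jump and a random variable `L`
from the jump on. For such a process the martingale property between `s ≤ t` is trivial on `{γ ≤ s}`
and a single scalar identity on `{s < γ}` (`condExp_eq_of_jumpProcess`). Writing `L = H(γ) + L'`
with `H(γ)` the generalized conditional expectation of `L` given `γ` (`exists_generalized_condExp`)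
turns this identity into the defining relation of Condition M.

Localization costs nothing: stopping times are deterministic before the jump
(`lt_of_isStoppingTime`), so one path with `γ ≥ t` and `τ n > t` forces `τ n` to stop before `t`
only where `M` is already constant. Local martingales are thus martingales up to each `t ∈ 𝒯`.
Conversely, a martingale up to each such time is localized by `preJumpTime`, which waits forever
once the jump has occurred.

The relation on `𝒯` is equivalent to Condition M: at `t_G`, relevant only in Case B, the survival
function vanishes and the relation becomes the limit condition; local absolute continuity is
automatic, by integration by parts (`eq_add_setIntegral_of_mul_add_eq`, `conditionM_of_main`). -/

lemma tendsto_setIntegral_Ioc_right (hut : u ≤ t) (hf : IntegrableOn f (Ioc 0 t) μ) :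
    Tendsto (fun s => ∫ x in Ioc 0 s, f x ∂μ) (𝓝[Icc u t] u) (𝓝 (∫ x in Ioc 0 u, f x ∂μ)) := by
  have key : ∀ s ≤ t, ∫ x in Ioc 0 s, f x ∂μ
      = ∫ x in Ioc 0 t, (Ioc 0 s).indicator f x ∂μ := fun s hs => by
    rw [setIntegral_indicator measurableSet_Ioc,
      inter_eq_right.2 (Ioc_subset_Ioc_right hs)]
  rw [key u hut]
  have h1 : Tendsto (fun s => ∫ x in Ioc 0 t, (Ioc 0 s).indicator f x ∂μ) (𝓝[Icc u t] u)
      (𝓝 (∫ x in Ioc 0 t, (Ioc 0 u).indicator f x ∂μ)) := by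
    refine tendsto_integral_filter_of_dominated_convergence (fun x => ‖f x‖) ?_ ?_ hf.norm ?_
    · exact Eventually.of_forall fun s => hf.aestronglyMeasurable.indicator measurableSet_Ioc
    · exact Eventually.of_forall fun s => Eventually.of_forall fun x =>
        norm_indicator_le_norm_self _ _
    · refine Eventually.of_forall fun x => ?_
      rcases le_or_gt x u with hx | hx
      · refine tendsto_const_nhds.congr' ?_
        filter_upwards [self_mem_nhdsWithin] with s hs
        simp only [indicator, mem_Ioc, hx, hx.trans hs.1]
      · refine tendsto_const_nhds.congr' ?_
        filter_upwards [mem_nhdsWithin_of_mem_nhds (Iio_mem_nhds hx)] with s hs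
        simp only [indicator, mem_Ioc, not_le.2 hx, not_le.2 (mem_Iio.1 hs), and_false]
  refine h1.congr' ?_
  filter_upwards [self_mem_nhdsWithin] with s hs
  rw [key s hs.2]

/-- The indicators of `Ioc 0 s` increase to that of `Ioo 0 u`, so the atom at `u` is lost in the
limit. -/
lemma tendsto_setIntegral_Ioc_left (hut : u ≤ t) (hf : IntegrableOn f (Ioo 0 t) μ) :
    Tendsto (fun s => ∫ x in Ioc 0 s, f x ∂μ) (𝓝[<] u) (𝓝 (∫ x in Ioo 0 u, f x ∂μ)) := by
  have key : ∀ s < u, ∫ x in Ioc 0 s, f x ∂μ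
      = ∫ x in Ioo 0 t, (Ioc 0 s).indicator f x ∂μ := fun s hs => by
    rw [setIntegral_indicator measurableSet_Ioc,
      inter_eq_right.2 ((Ioc_subset_Ioo_right hs).trans (Ioo_subset_Ioo_right hut))]
  have key' : ∫ x in Ioo 0 u, f x ∂μ = ∫ x in Ioo 0 t, (Ioo 0 u).indicator f x ∂μ := by
    rw [setIntegral_indicator measurableSet_Ioo,
      inter_eq_right.2 (Ioo_subset_Ioo_right hut)]
  rw [key']
  have h1 : Tendsto (fun s => ∫ x in Ioo 0 t, (Ioc 0 s).indicator f x ∂μ) (𝓝[<] u)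
      (𝓝 (∫ x in Ioo 0 t, (Ioo 0 u).indicator f x ∂μ)) := by
    refine tendsto_integral_filter_of_dominated_convergence (fun x => ‖f x‖) ?_ ?_ hf.norm ?_
    · exact Eventually.of_forall fun s => hf.aestronglyMeasurable.indicator measurableSet_Ioc
    · exact Eventually.of_forall fun s => Eventually.of_forall fun x =>
        norm_indicator_le_norm_self _ _
    · refine Eventually.of_forall fun x => ?_
      rcases lt_or_ge x u with hx | hx
      · refine tendsto_const_nhds.congr' ?_
        filter_upwards [mem_nhdsWithin_of_mem_nhds (Ioi_mem_nhds hx)] with s hs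
        simp only [indicator, mem_Ioc, mem_Ioo, hx, (mem_Ioi.1 hs).le]
      · refine tendsto_const_nhds.congr' ?_
        filter_upwards [self_mem_nhdsWithin] with s hs
        simp only [indicator, mem_Ioc, mem_Ioo, not_lt.2 hx, not_le.2 (lt_of_lt_of_le hs hx)]
  refine h1.congr' ?_
  filter_upwards [self_mem_nhdsWithin] with s hs
  rw [key s hs]

variable [IsFiniteMeasure μ] {g F H : ℝ≥0 → ℝ} {C : ℝ}

lemma tendsto_right_of_sub_eq (hg : ∀ a b, a ≤ b → g a - g b = μ.real (Ioc a b)) (hut : u ≤ t) :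
    Tendsto g (𝓝[Icc u t] u) (𝓝 (g u)) := by
  have h := tendsto_setIntegral_Ioc_right (μ := μ) (f := fun _ => (1 : ℝ)) hut
    (integrableOn_const (by simp))
  simp only [setIntegral_const, smul_eq_mul, mul_one] at h
  have e : ∀ s, g s = g 0 - μ.real (Ioc 0 s) := fun s => by linarith [hg 0 s zero_le]
  rw [e u]
  exact (tendsto_const_nhds.sub h).congr fun s => (e s).symm

lemma tendsto_left_of_sub_eq (hg : ∀ a b, a ≤ b → g a - g b = μ.real (Ioc a b)) (hu : 0 < u) :
    Tendsto g (𝓝[<] u) (𝓝 (g u + μ.real {u})) := by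
  have h := tendsto_setIntegral_Ioc_left (μ := μ) (f := fun _ => (1 : ℝ)) le_rfl (u := u)
    (integrableOn_const (by simp))
  simp only [setIntegral_const, smul_eq_mul, mul_one] at h
  have e : ∀ s, g s = g 0 - μ.real (Ioc 0 s) := fun s => by linarith [hg 0 s zero_le]
  have e' : μ.real (Ioc 0 u) = μ.real (Ioo 0 u) + μ.real {u} := by
    rw [← Ioo_union_right hu, measureReal_union (by simp) (measurableSet_singleton u)]
  rw [e u, e', show g 0 - (μ.real (Ioo 0 u) + μ.real {u}) + μ.real {u}
    = g 0 - μ.real (Ioo 0 u) by ring]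
  exact (tendsto_const_nhds.sub h).congr fun s => (e s).symm

/-- Integration by parts: if `F g + ∫ H dμ` is constant on `[0, t]`, where `dg = -dμ`, then
`dF = (F - H) / g₋ dμ` on `(0, t]`. -/
theorem eq_add_setIntegral_of_mul_add_eq
    (hg : ∀ a b, a ≤ b → g a - g b = μ.real (Ioc a b)) (hgt : 0 < g t)
    (hH : IntegrableOn H (Ioc 0 t) μ)
    (hF : ∀ s ≤ t, F s * g s + ∫ x in Ioc 0 s, H x ∂μ = C) :
    F t = F 0 + ∫ x in Ioc 0 t, (F x - H x) / (g x + μ.real {x}) ∂μ := by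
  rcases (zero_le : 0 ≤ t).eq_or_lt with rfl | ht
  · simp
  have hanti : Antitone g := fun a b hab => by
    have := hg a b hab
    linarith [measureReal_nonneg (μ := μ) (s := Ioc a b)]
  have hgpos : ∀ s ≤ t, g t ≤ g s := fun s hs => hanti hs
  have hFeq : ∀ s ≤ t, F s = (C - ∫ x in Ioc 0 s, H x ∂μ) / g s := fun s hs => by
    rw [eq_div_iff (hgt.trans_le (hgpos s hs)).ne', ← hF s hs]; ring
  have hFr : ∀ u ≤ t, Tendsto F (𝓝[Icc u t] u) (𝓝 (F u)) := fun u hu => by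
    rw [hFeq u hu]
    refine ((tendsto_const_nhds.sub (tendsto_setIntegral_Ioc_right hu hH)).div
      (tendsto_right_of_sub_eq hg hu) (hgt.trans_le (hgpos u hu)).ne').congr' ?_
    filter_upwards [self_mem_nhdsWithin] with s hs
    exact (hFeq s hs.2).symm
  obtain ⟨K, hK⟩ : ∃ K, ∀ s ≤ t, |F s| ≤ K := by
    refine ⟨(|C| + ∫ x in Ioc 0 t, ‖H x‖ ∂μ) / g t, fun s hs => ?_⟩
    rw [hFeq s hs, abs_div, abs_of_pos (hgt.trans_le (hgpos s hs))]
    have h1 : |∫ x in Ioc 0 s, H x ∂μ| ≤ ∫ x in Ioc 0 t, ‖H x‖ ∂μ :=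
      (norm_integral_le_integral_norm _).trans
        (setIntegral_mono_set hH.norm (Eventually.of_forall fun _ => norm_nonneg _)
          (Ioc_subset_Ioc_right hs).eventuallyLE)
    have h2 : 0 ≤ ∫ x in Ioc 0 t, ‖H x‖ ∂μ := integral_nonneg fun _ => norm_nonneg _
    gcongr
    · exact (abs_sub _ _).trans (by gcongr)
    · exact hgpos s hs
  set a : ℕ → ℕ → ℝ≥0 := fun n i => i * t / (n + 1) with ha
  have ha_mono : ∀ n, Monotone (a n) := fun n i j hij => by
    simp only [ha]; gcongr
  have ha0 : ∀ n, a n 0 = 0 := fun n => by simp [ha]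
  have ha1 : ∀ n, a n (n + 1) = t := fun n => by
    simp only [ha]; push_cast; field_simp
  have hat : ∀ n i, i ≤ n + 1 → a n i ≤ t := fun n i hi => (ha_mono n hi).trans (ha1 n).le
  have hastep : ∀ n i, a n (i + 1) = a n i + t / (n + 1) := fun n i => by
    simp only [ha]; push_cast; ring
  -- Approximate integrands on the grid: `F` is taken at the right end of each cell and `g` at the
  -- left end. With this pairing the discrete product rule is exact, so the integral of `φ n`
  -- telescopes to `F t - F 0`.
  set φ : ℕ → ℝ≥0 → ℝ := fun n x => ∑ i ∈ Finset.range (n + 1),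
    (Ioc (a n i) (a n (i + 1))).indicator (fun x => (F (a n (i + 1)) - H x) / g (a n i)) x with hφ
  have hsub : ∀ n i, i < n + 1 → Ioc (a n i) (a n (i + 1)) ⊆ Ioc 0 t := fun n i hi =>
    Ioc_subset_Ioc zero_le (hat n _ hi)
  have hpart : ∀ n i, i < n + 1 →
      IntegrableOn (fun x => (F (a n (i + 1)) - H x) / g (a n i)) (Ioc (a n i) (a n (i + 1))) μ :=
    fun n i hi => ((integrableOn_const (by simp)).sub (hH.mono_set (hsub n i hi))).div_const _
  have hone : ∀ n i, i < n + 1 → ∫ x in Ioc (a n i) (a n (i + 1)),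
      (F (a n (i + 1)) - H x) / g (a n i) ∂μ = F (a n (i + 1)) - F (a n i) := by
    intro n i hi
    have h1 := hF (a n i) (hat n i hi.le)
    have h2 := hF (a n (i + 1)) (hat n _ hi)
    have hle := ha_mono n (Nat.le_succ i)
    have h3 : ∫ x in Ioc 0 (a n (i + 1)), H x ∂μ
        = ∫ x in Ioc 0 (a n i), H x ∂μ + ∫ x in Ioc (a n i) (a n (i + 1)), H x ∂μ := by
      rw [← Ioc_union_Ioc_eq_Ioc zero_le hle]
      exact setIntegral_union (Ioc_disjoint_Ioc_of_le le_rfl) measurableSet_Ioc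
        (hH.mono_set (Ioc_subset_Ioc_right (hat n i hi.le))) (hH.mono_set (hsub n i hi))
    have hpos := hgt.trans_le (hgpos _ (hat n i hi.le))
    rw [integral_div, integral_sub (integrable_const _) (hH.mono_set (hsub n i hi)),
      setIntegral_const, smul_eq_mul, div_eq_iff hpos.ne', ← hg _ _ hle]
    linarith
  have hint : ∀ n, ∫ x in Ioc 0 t, φ n x ∂μ = F t - F 0 := by
    intro n
    rw [hφ]
    dsimp only
    rw [integral_finsetSum]
    · rw [Finset.sum_congr rfl (g := fun i => F (a n (i + 1)) - F (a n i)),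
        Finset.sum_range_sub (fun i => F (a n i)), ha0, ha1]
      intro i hi
      have hi := Finset.mem_range.1 hi
      rw [setIntegral_indicator measurableSet_Ioc, inter_eq_right.2 (hsub n i hi), hone n i hi]
    · intro i hi
      have hi := Finset.mem_range.1 hi
      exact ((integrable_indicator_iff measurableSet_Ioc).2 (hpart n i hi)).integrableOn
  have hloc : ∀ n, ∀ x ∈ Ioc 0 t, ∃ i < n + 1, x ∈ Ioc (a n i) (a n (i + 1)) := by
    intro n x hx
    have hex : ∃ i, x ≤ a n i := ⟨n + 1, (ha1 n).symm ▸ hx.2⟩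
    obtain ⟨i, hi⟩ : ∃ i, Nat.find hex = i + 1 := Nat.exists_eq_succ_of_ne_zero fun h0 => by
      have := Nat.find_spec hex
      rw [h0, ha0] at this
      exact absurd hx.1 (not_lt.2 this)
    refine ⟨i, ?_, not_le.1 (Nat.find_min hex (by omega)), hi ▸ Nat.find_spec hex⟩
    have : Nat.find hex ≤ n + 1 := Nat.find_min' hex ((ha1 n).symm ▸ hx.2)
    omega
  have hval : ∀ n, ∀ x, ∀ i < n + 1, x ∈ Ioc (a n i) (a n (i + 1)) →
      φ n x = (F (a n (i + 1)) - H x) / g (a n i) := by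
    intro n x i hi hx
    rw [hφ]
    dsimp only
    rw [Finset.sum_eq_single_of_mem i (Finset.mem_range.2 hi), indicator_of_mem hx]
    intro j _ hj
    refine indicator_of_notMem (fun hx' => ?_) _
    rcases lt_or_gt_of_ne hj with h | h
    · exact absurd (hx.1.trans_le (hx'.2.trans (ha_mono n h))) (lt_irrefl _)
    · exact absurd (hx'.1.trans_le (hx.2.trans (ha_mono n h))) (lt_irrefl _)
  have hlim : Tendsto (fun n => ∫ x in Ioc 0 t, φ n x ∂μ) atTop
      (𝓝 (∫ x in Ioc 0 t, (F x - H x) / (g x + μ.real {x}) ∂μ)) := by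
    refine tendsto_integral_of_dominated_convergence (fun x => (K + ‖H x‖) / g t) ?_ ?_ ?_ ?_
    · intro n
      refine Finset.aestronglyMeasurable_fun_sum _ fun i hi => ?_
      exact ((integrable_indicator_iff measurableSet_Ioc).2
        (hpart n i (Finset.mem_range.1 hi))).aestronglyMeasurable.restrict
    · exact ((integrableOn_const (by simp)).add hH.norm).div_const _
    · intro n
      filter_upwards [ae_restrict_mem measurableSet_Ioc] with x hx
      obtain ⟨i, hi, hxi⟩ := hloc n x hx
      rw [hval n x i hi hxi, norm_div, Real.norm_of_nonneg (r := g _)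
        (hgt.trans_le (hgpos _ (hat n i hi.le))).le]
      have hK0 : 0 ≤ K := (abs_nonneg _).trans (hK t le_rfl)
      gcongr
      · exact (norm_sub_le _ _).trans (add_le_add_left (hK _ (hat n _ hi)) _)
      · exact hgpos _ (hat n i hi.le)
    · filter_upwards [ae_restrict_mem measurableSet_Ioc] with x hx
      choose i hi hxi using fun n => hloc n x hx
      have hstep0 : Tendsto (fun n : ℕ => t / ((n : ℝ≥0) + 1)) atTop (𝓝 0) := by
        have := tendsto_one_div_add_atTop_nhds_zero_nat (𝕜 := ℝ≥0)
        simpa [div_eq_mul_inv] using this.const_mul t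
      -- Right ends approach `x` from `[x, t]`, where `F` is right-continuous; left ends stay
      -- strictly below `x`, so `g` there tends to its left limit `g x + μ {x}`.
      have hρ : Tendsto (fun n => a n (i n + 1)) atTop (𝓝[Icc x t] x) := by
        refine tendsto_nhdsWithin_iff.2 ⟨?_, Eventually.of_forall fun n =>
          ⟨(hxi n).2, hat n _ (hi n)⟩⟩
        refine tendsto_of_tendsto_of_tendsto_of_le_of_le tendsto_const_nhds
          (by simpa using tendsto_const_nhds (x := x).add hstep0) (fun n => (hxi n).2) fun n => ?_
        dsimp only
        rw [hastep]
        gcongr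
        exact (hxi n).1.le
      have hl : Tendsto (fun n => a n (i n)) atTop (𝓝[<] x) := by
        refine tendsto_nhdsWithin_iff.2 ⟨?_, Eventually.of_forall fun n => (hxi n).1⟩
        refine tendsto_of_tendsto_of_tendsto_of_le_of_le
          (by simpa using tendsto_const_nhds (x := x).sub hstep0) tendsto_const_nhds
          (fun n => ?_) fun n => (hxi n).1.le
        dsimp only
        rw [tsub_le_iff_right, ← hastep]
        exact (hxi n).2
      have hgx : g x + μ.real {x} ≠ 0 :=
        (add_pos_of_pos_of_nonneg (hgt.trans_le (hgpos x hx.2)) measureReal_nonneg).ne'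
      refine ((((hFr x hx.2).comp hρ).sub tendsto_const_nhds).div
        ((tendsto_left_of_sub_eq hg hx.1).comp hl) hgx).congr fun n => ?_
      exact (hval n x (i n) (hi n) (hxi n)).symm
  simp only [hint] at hlim
  linarith [tendsto_nhds_unique hlim tendsto_const_nhds]

end Stieltjes

/-! ### The law of the jump time -/

section Law

variable {ν : Measure ℝ≥0∞}

lemma measurableEmbedding_coe : MeasurableEmbedding ((↑) : ℝ≥0 → ℝ≥0∞) :=
  ENNReal.isOpenEmbedding_coe.measurableEmbedding

lemma dG_apply (ν : Measure ℝ≥0∞) (s : Set ℝ≥0) : dG ν s = ν ((↑) '' s) :=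
  measurableEmbedding_coe.comap_apply ν s

instance [IsFiniteMeasure ν] : IsFiniteMeasure (dG ν) :=
  ⟨by rw [dG_apply]; exact measure_lt_top _ _⟩

lemma image_coe_Ioc (a b : ℝ≥0) : ((↑) : ℝ≥0 → ℝ≥0∞) '' Ioc a b = Ioc (a : ℝ≥0∞) b :=
  ENNReal.image_coe_Ioc a b

lemma mem_timeSet_of_le {s t : ℝ≥0} (hst : s ≤ t) (ht : t ∈ timeSet ν) : s ∈ timeSet ν :=
  lt_of_lt_of_le (show 0 < ν (Ici (t : ℝ≥0∞)) from ht)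
    (measure_mono (Ici_subset_Ici.2 (ENNReal.coe_le_coe.2 hst)))

lemma ordConnected_timeSet : (timeSet ν).OrdConnected :=
  ⟨fun _ _ _ hy _ hz => mem_timeSet_of_le hz.2 hy⟩

/-- The set of points beyond which a measure on a line has no mass is a null set. -/
lemma measure_setOf_measure_Ici_eq_zero (ν : Measure ℝ≥0∞) : ν {x | ν (Ici x) = 0} = 0 := by
  set U := {x : ℝ≥0∞ | ν (Ici x) = 0} with hU
  by_cases hmin : ∃ a ∈ U, ∀ x ∈ U, a ≤ x
  · obtain ⟨a, ha, hmin⟩ := hmin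
    exact measure_mono_null (fun x hx => hmin x hx) ha
  -- Without a least element, `U` is covered by the open rays `Ioi x`, `x ∈ U`, all null; by
  -- Lindelöf countably many suffice.
  · push Not at hmin
    obtain ⟨T, hT, hTU⟩ := TopologicalSpace.isOpen_iUnion_countable
      (fun x : U => Ioi (x : ℝ≥0∞)) fun x => isOpen_Ioi
    have hsub : U ⊆ ⋃ x ∈ T, Ioi (x : ℝ≥0∞) := by
      rw [hTU]
      intro x hx
      obtain ⟨y, hy, hyx⟩ := hmin x hx
      exact mem_iUnion.2 ⟨⟨y, hy⟩, hyx⟩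
    refine measure_mono_null hsub ((measure_biUnion_null_iff hT).2 fun x _ => ?_)
    exact measure_mono_null Ioi_subset_Ici_self x.2

lemma ae_measure_Ici_pos (ν : Measure ℝ≥0∞) : ∀ᵐ x ∂ν, 0 < ν (Ici x) := by
  rw [ae_iff]
  simpa using measure_setOf_measure_Ici_eq_zero ν

/-- The time set has a cofinal monotone sequence. -/
lemma exists_monotone_cofinal_timeSet (h0 : 0 ∈ timeSet ν) :
    ∃ u : ℕ → ℝ≥0, Monotone u ∧ (∀ n, u n ∈ timeSet ν) ∧
      ∀ t ∈ timeSet ν, ∀ᶠ n in atTop, t ≤ u n := by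
  have : Nonempty (timeSet ν) := ⟨⟨0, h0⟩⟩
  have := ordConnected_timeSet (ν := ν)
  obtain ⟨v, hv, hv'⟩ := exists_seq_monotone_tendsto_atTop_atTop (timeSet ν)
  refine ⟨fun n => v n, fun i j hij => hv hij, fun n => (v n).2, fun t ht => ?_⟩
  exact hv'.eventually (eventually_ge_atTop ⟨t, ht⟩)

lemma toNNReal_tG_mem_timeSet (h : CaseB ν) : (tG ν).toNNReal ∈ timeSet ν := by
  show 0 < ν (Ici _)
  rw [ENNReal.coe_toNNReal h.1.ne]
  exact h.2.trans_le (measure_mono (singleton_subset_iff.2 self_mem_Ici))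

variable [IsProbabilityMeasure ν]

lemma Gbar_eq (t : ℝ≥0) : Gbar ν t = ν.real (Ioi (t : ℝ≥0∞)) := by
  rw [Gbar, G, ← compl_Iic, probReal_compl_eq_one_sub measurableSet_Iic]

lemma Gbar_nonneg (t : ℝ≥0) : 0 ≤ Gbar ν t := by
  rw [Gbar_eq]; exact measureReal_nonneg

lemma Gbar_sub_Gbar {a b : ℝ≥0} (hab : a ≤ b) : Gbar ν a - Gbar ν b = (dG ν).real (Ioc a b) := by
  rw [Gbar_eq, Gbar_eq, measureReal_def (dG ν), dG_apply, image_coe_Ioc, ← measureReal_def,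
    ← Ioc_union_Ioi_eq_Ioi (ENNReal.coe_le_coe.2 hab),
    measureReal_union (Ioc_disjoint_Ioi le_rfl) measurableSet_Ioi]
  ring

lemma Gbar_antitone : Antitone (Gbar ν) := fun a b hab => by
  have := Gbar_sub_Gbar (ν := ν) hab
  linarith [measureReal_nonneg (μ := dG ν) (s := Ioc a b)]

/-- This is the left limit of the survival function at `t`, the denominator in the density of `F`.
-/
lemma Gbar_add_measureReal_singleton (t : ℝ≥0) :
    Gbar ν t + (dG ν).real {t} = ν.real (Ici (t : ℝ≥0∞)) := by
  rw [Gbar_eq, measureReal_def (dG ν), dG_apply, image_singleton, ← measureReal_def, add_comm,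
    ← Ioi_insert, insert_eq, measureReal_union (by simp) measurableSet_Ioi]

lemma Gbar_pos_of_lt_tG {t : ℝ≥0} (ht : (t : ℝ≥0∞) < tG ν) : 0 < Gbar ν t := by
  obtain ⟨x, ⟨s, hs, rfl⟩, hts⟩ := lt_sSup_iff.1 ht
  have : 0 < Gbar ν s := by rw [Gbar]; linarith
  exact this.trans_le (Gbar_antitone (ENNReal.coe_le_coe.1 hts.le))

lemma measure_Ioi_tG (ν : Measure ℝ≥0∞) [IsProbabilityMeasure ν] : ν (Ioi (tG ν)) = 0 := by
  refine measure_mono_null (fun x hx => ?_) (measure_setOf_measure_Ici_eq_zero ν)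
  obtain ⟨s, hs1, hs2⟩ := ENNReal.lt_iff_exists_nnreal_btwn.1 (mem_Ioi.1 hx)
  have h1 : ¬ G ν s < 1 := fun h => (le_sSup ⟨s, h, rfl⟩ : (s : ℝ≥0∞) ≤ tG ν).not_gt hs1
  have h2 : Gbar ν s ≤ 0 := by rw [Gbar]; linarith
  have h3 : ν.real (Ioi (s : ℝ≥0∞)) = 0 := by
    rw [← Gbar_eq]; exact le_antisymm h2 (Gbar_nonneg s)
  exact measure_mono_null (Ici_subset_Ioi.2 hs2) ((measureReal_eq_zero_iff (by simp)).1 h3)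

lemma mem_timeSet_of_lt_tG {t : ℝ≥0} (ht : (t : ℝ≥0∞) < tG ν) : t ∈ timeSet ν := by
  have h := Gbar_pos_of_lt_tG ht
  rw [Gbar_eq, measureReal_def] at h
  exact (ENNReal.toReal_pos_iff.1 h).1.trans_le (measure_mono Ioi_subset_Ici_self)

/-- There is no mass beyond `t_G`, so the only point that `𝒯` can have outside `[0, t_G)` is `t_G`
itself, and only if it is an atom. -/
lemma caseB_of_mem_timeSet {t : ℝ≥0} (ht : t ∈ timeSet ν) (ht' : ¬ (t : ℝ≥0∞) < tG ν) :
    CaseB ν ∧ (t : ℝ≥0∞) = tG ν := by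
  have hle := not_lt.1 ht'
  have heq : (t : ℝ≥0∞) = tG ν := by
    refine le_antisymm (not_lt.1 fun hlt => ?_) hle
    exact (show 0 < ν (Ici (t : ℝ≥0∞)) from ht).ne'
      (measure_mono_null (Ici_subset_Ioi.2 hlt) (measure_Ioi_tG ν))
  refine ⟨⟨hle.trans_lt ENNReal.coe_lt_top, ?_⟩, heq⟩
  have h : 0 < ν (Ici (tG ν)) := heq ▸ ht
  rw [← Ioi_insert, insert_eq] at h
  exact h.trans_le ((measure_union_le _ _).trans (by rw [measure_Ioi_tG, add_zero]))

lemma Gbar_tG (h : tG ν < ∞) : Gbar ν (tG ν).toNNReal = 0 := by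
  rw [Gbar_eq, ENNReal.coe_toNNReal h.ne, measureReal_def, measure_Ioi_tG, ENNReal.toReal_zero]

lemma tG_pos (h : 0 < Gbar ν 0) : 0 < tG ν := by
  refine pos_iff_ne_zero.2 fun h0 => h.ne' ?_
  have := measure_Ioi_tG ν
  rw [h0] at this
  rw [Gbar_eq, ENNReal.coe_zero, measureReal_def, this, ENNReal.toReal_zero]

end Law

/-! ### Integrals with respect to `dG` -/

section Integrals

variable {Ω : Type*} [mΩ : MeasurableSpace Ω] {P : Measure Ω} {γ : Ω → ℝ≥0∞}

/-- Restricting to `γ ∈ s` discards `{γ = ∞}`, where `toNNReal` has the default value `0`. -/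
lemma dG_map_restrict (hγ : Measurable γ) {s : Set ℝ≥0} (hs : MeasurableSet s) :
    (dG (P.map γ)).restrict s
      = (P.restrict (γ ⁻¹' ((↑) '' s))).map (fun ω => (γ ω).toNNReal) := by
  have hm : Measurable fun ω => (γ ω).toNNReal := hγ.ennreal_toNNReal
  ext A hA
  have h1 : MeasurableSet (((↑) : ℝ≥0 → ℝ≥0∞) '' (A ∩ s)) :=
    measurableEmbedding_coe.measurableSet_image.2 (hA.inter hs)
  rw [Measure.restrict_apply hA, dG_apply, Measure.map_apply hγ h1, Measure.map_apply hm hA,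
    Measure.restrict_apply (hm hA)]
  congr 1
  ext ω
  simp only [mem_preimage, mem_image, mem_inter_iff]
  constructor
  · rintro ⟨x, ⟨hxA, hxs⟩, hx⟩
    rw [← hx]
    exact ⟨by simpa using hxA, x, hxs, rfl⟩
  · rintro ⟨hA, x, hxs, hx⟩
    rw [← hx] at hA ⊢
    exact ⟨x, ⟨by simpa using hA, hxs⟩, rfl⟩

variable {f : ℝ≥0 → ℝ}

lemma integrableOn_dG_map (hγ : Measurable γ) {s : Set ℝ≥0} (hs : MeasurableSet s)
    (hf : IntegrableOn f s (dG (P.map γ))) :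
    IntegrableOn (fun ω => f (γ ω).toNNReal) (γ ⁻¹' ((↑) '' s)) P := by
  rw [IntegrableOn, dG_map_restrict hγ hs] at hf
  exact (integrable_map_measure hf.aestronglyMeasurable
    hγ.ennreal_toNNReal.aemeasurable).1 hf

lemma integrableOn_dG_map_of_measurable (hγ : Measurable γ) {s : Set ℝ≥0} (hs : MeasurableSet s)
    (hf : Measurable f) (hfi : IntegrableOn (fun ω => f (γ ω).toNNReal) (γ ⁻¹' ((↑) '' s)) P) :
    IntegrableOn f s (dG (P.map γ)) := by
  rw [IntegrableOn, dG_map_restrict hγ hs]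
  exact (integrable_map_measure hf.aestronglyMeasurable
    hγ.ennreal_toNNReal.aemeasurable).2 hfi

lemma setIntegral_dG_map (hγ : Measurable γ) {s : Set ℝ≥0} (hs : MeasurableSet s)
    (hf : IntegrableOn f s (dG (P.map γ))) :
    ∫ x in s, f x ∂(dG (P.map γ)) = ∫ ω in γ ⁻¹' ((↑) '' s), f (γ ω).toNNReal ∂P := by
  rw [IntegrableOn, dG_map_restrict hγ hs] at hf
  rw [dG_map_restrict hγ hs, integral_map hγ.ennreal_toNNReal.aemeasurable
    hf.aestronglyMeasurable]

lemma image_coe_Icc_zero (t : ℝ≥0) : ((↑) : ℝ≥0 → ℝ≥0∞) '' Icc 0 t = Iic (t : ℝ≥0∞) := by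
  rw [ENNReal.image_coe_Icc, ENNReal.coe_zero, ← bot_eq_zero, Icc_bot]

end Integrals

/-! ### The single jump filtration -/

section Filtration

variable {Ω : Type*} [mΩ : MeasurableSpace Ω] {γ : Ω → ℝ≥0∞} {t : ℝ≥0}

lemma measurableSet_filtration_iff {A : Set Ω} :
    MeasurableSet[filtration γ t] A ↔ MeasurableSet A ∧
      (A ∩ {ω | (t : ℝ≥0∞) < γ ω} = ∅ ∨
        A ∩ {ω | (t : ℝ≥0∞) < γ ω} = {ω | (t : ℝ≥0∞) < γ ω}) := Iff.rfl

lemma measurableSet_filtration_le (hγ : Measurable γ) {s : ℝ≥0} (hst : s ≤ t) :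
    MeasurableSet[filtration γ t] {ω | γ ω ≤ (s : ℝ≥0∞)} := by
  refine measurableSet_filtration_iff.2 ⟨measurableSet_le hγ measurable_const, Or.inl ?_⟩
  ext ω
  simp only [mem_inter_iff, mem_ofPred_eq, mem_empty_iff_false, iff_false, not_and, not_lt]
  exact fun h => h.trans (ENNReal.coe_le_coe.2 hst)

/-- The function is constantly `0` on `{t < γ}`, so the filtration asks no more of it than ambient
measurability. -/
lemma measurable_filtration_indicator (hγ : Measurable γ) {f : Ω → ℝ} (hf : Measurable f) :
    Measurable[filtration γ t] ({ω | γ ω ≤ (t : ℝ≥0∞)}.indicator f) := by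
  intro B hB
  refine measurableSet_filtration_iff.2
    ⟨(hf.indicator (measurableSet_le hγ measurable_const)) hB, ?_⟩
  have hz : ∀ ω, (t : ℝ≥0∞) < γ ω → {ω | γ ω ≤ (t : ℝ≥0∞)}.indicator f ω = 0 := fun ω hω =>
    indicator_of_notMem (by simpa using hω) f
  by_cases h0 : (0 : ℝ) ∈ B
  · right
    refine inter_eq_right.2 fun ω hω => ?_
    rw [mem_preimage, hz ω hω]
    exact h0
  · left
    ext ω
    simp only [mem_inter_iff, mem_preimage, mem_ofPred_eq, mem_empty_iff_false, iff_false, not_and]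
    intro h hω
    rw [hz ω hω] at h
    exact h0 h

/-- The level set of `M t` through `ω'` meets `{t < γ}`, hence contains it. -/
lemma eq_of_adapted {M : ℝ≥0 → Ω → ℝ} (hM : Adapted (filtration γ) M) {ω ω' : Ω}
    (hω : (t : ℝ≥0∞) < γ ω) (hω' : (t : ℝ≥0∞) < γ ω') : M t ω = M t ω' := by
  rcases (measurableSet_filtration_iff.1 (hM t (measurableSet_singleton (M t ω')))).2 with h | h
  · exact absurd (show ω' ∈ (∅ : Set Ω) from h ▸ ⟨rfl, hω'⟩) (notMem_empty _)
  · exact (h.symm ▸ hω : ω ∈ M t ⁻¹' {M t ω'} ∩ {ω | (t : ℝ≥0∞) < γ ω}).1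

/-- A stopping time of the single jump filtration which does not stop before `t` on one path that
has not jumped before `t` can stop before `t` only after the jump. -/
lemma lt_of_isStoppingTime {τ : Ω → WithTop ℝ≥0} (hτ : IsStoppingTime (filtration γ) τ)
    {ω₀ : Ω} (h1 : (t : WithTop ℝ≥0) ≤ τ ω₀) (h2 : (t : ℝ≥0∞) ≤ γ ω₀) {ω : Ω} {u : ℝ≥0}
    (hut : u < t) (hu : (u : ℝ≥0∞) < γ ω) : (u : WithTop ℝ≥0) < τ ω := by
  by_contra hcon
  have hcon := not_lt.1 hcon
  have hu0 : (u : ℝ≥0∞) < γ ω₀ := (ENNReal.coe_lt_coe.2 hut).trans_le h2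
  rcases (measurableSet_filtration_iff.1 (hτ u)).2 with h | h
  · exact absurd (show ω ∈ (∅ : Set Ω) from h ▸ ⟨hcon, hu⟩) (notMem_empty _)
  · have h3 : τ ω₀ ≤ u :=
      (h.symm ▸ hu0 : ω₀ ∈ {ω | τ ω ≤ u} ∩ {ω | (u : ℝ≥0∞) < γ ω}).1
    exact absurd (WithTop.coe_le_coe.1 (h1.trans h3)) (not_le.2 hut)

end Filtration

/-! ### Generalized conditional expectations -/

section CondExp

variable {Ω β : Type*} [mΩ : MeasurableSpace Ω] [mβ : MeasurableSpace β] {P : Measure Ω}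
  [IsProbabilityMeasure P] {γ : Ω → β}

/-- A random variable integrable on each of an increasing sequence of events of `σ(γ)` covering
the space has a generalized conditional expectation of the form `h(γ)`. -/
lemma exists_generalized_condExp (hγ : Measurable γ) {L : Ω → ℝ}
    {s : ℕ → Set β} (hs : ∀ n, MeasurableSet (s n)) (hmono : Monotone s)
    (hint : ∀ n, IntegrableOn L (γ ⁻¹' s n) P) :
    ∃ h : β → ℝ, Measurable h ∧ (∀ n, IntegrableOn (fun ω => h (γ ω)) (γ ⁻¹' s n) P) ∧
      ∀ n, P[(γ ⁻¹' s n).indicator (fun ω => L ω - h (γ ω)) | mβ.comap γ] =ᵐ[P] 0 := by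
  have hm : mβ.comap γ ≤ mΩ := hγ.comap_le
  have hsm : ∀ n, MeasurableSet[mβ.comap γ] (γ ⁻¹' s n) := fun n => ⟨s n, hs n, rfl⟩
  have hsm' : ∀ n, MeasurableSet (γ ⁻¹' s n) := fun n => hγ (hs n)
  have hL : ∀ n, Integrable ((γ ⁻¹' s n).indicator L) P := fun n =>
    (integrable_indicator_iff (hsm' n)).2 (hint n)
  have hex : ∀ n, ∃ φ : β → ℝ, StronglyMeasurable φ ∧
      P[(γ ⁻¹' s n).indicator L | mβ.comap γ] = φ ∘ γ := fun n =>
    stronglyMeasurable_condExp.exists_eq_measurable_comp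
  choose φ hφ hφe using hex
  -- By the tower property the versions `φ n` agree on common domains; the case `n = k` says that `φ
  -- n` vanishes off `s n`.
  have hcons : ∀ᵐ ω ∂P, ∀ n k, n ≤ k →
      φ n (γ ω) = (γ ⁻¹' s n).indicator (fun ω => φ k (γ ω)) ω := by
    refine ae_all_iff.2 fun n => ae_all_iff.2 fun k => ?_
    by_cases hnk : n ≤ k
    · have h1 := condExp_indicator (m := mβ.comap γ) (hL k) (hsm n)
      rw [indicator_indicator, inter_eq_left.2 (preimage_mono (hmono hnk)), hφe n, hφe k] at h1
      filter_upwards [h1] with ω hω _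
      exact hω
    · exact Eventually.of_forall fun _ h => absurd h hnk
  -- Glue along the disjoint differences of the `s n`; a point of `s n` lies in a piece of some
  -- index `k ≤ n`, where `φ k` and `φ n` agree.
  obtain ⟨h, hh, hhe⟩ := exists_measurable_piecewise (disjointed s)
    (fun n => MeasurableSet.disjointed hs n) φ (fun n => (hφ n).measurable) (by
      intro i j hij x hx
      exact absurd hx (by
        rw [disjoint_iff_inter_eq_empty.1 (disjoint_disjointed s hij)]; exact notMem_empty x))
  have hkey : ∀ n, (γ ⁻¹' s n).indicator (fun ω => h (γ ω))
      =ᵐ[P] P[(γ ⁻¹' s n).indicator L | mβ.comap γ] := by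
    intro n
    filter_upwards [hcons] with ω hω
    rw [hφe n, Function.comp_apply]
    by_cases hmem : γ ω ∈ s n
    · have h1 : γ ω ∈ ⋃ k ∈ Finset.range (n + 1), disjointed s k := by
        rw [biUnion_range_succ_disjointed, hmono.partialSups_eq]
        exact hmem
      obtain ⟨k, hk, hγk⟩ := mem_iUnion₂.1 h1
      have hk := Nat.lt_succ_iff.1 (Finset.mem_range.1 hk)
      rw [indicator_of_mem (show ω ∈ γ ⁻¹' s n from hmem), hhe k hγk, hω k n hk,
        indicator_of_mem (show ω ∈ γ ⁻¹' s k from disjointed_subset s k hγk)]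
    · rw [hω n n le_rfl, indicator_of_notMem (show ω ∉ γ ⁻¹' s n from hmem),
        indicator_of_notMem (show ω ∉ γ ⁻¹' s n from hmem)]
  have hhint : ∀ n, Integrable ((γ ⁻¹' s n).indicator (fun ω => h (γ ω))) P := fun n =>
    integrable_condExp.congr (hkey n).symm
  refine ⟨h, hh, fun n => (integrable_indicator_iff (hsm' n)).1 (hhint n), fun n => ?_⟩
  have e : (γ ⁻¹' s n).indicator (fun ω => L ω - h (γ ω))
      = (γ ⁻¹' s n).indicator L - (γ ⁻¹' s n).indicator (fun ω => h (γ ω)) :=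
    indicator_sub' _ _ _
  rw [e]
  have h2 : P[(γ ⁻¹' s n).indicator (fun ω => h (γ ω)) | mβ.comap γ]
      =ᵐ[P] P[(γ ⁻¹' s n).indicator L | mβ.comap γ] := by
    refine (condExp_congr_ae (hkey n)).trans ?_
    rw [condExp_of_stronglyMeasurable hm stronglyMeasurable_condExp integrable_condExp]
  filter_upwards [condExp_sub (hL n) (hhint n) (mβ.comap γ), h2] with ω h3 h4
  rw [h3, Pi.sub_apply, h4, sub_self, Pi.zero_apply]

/-- A random variable with vanishing generalized conditional expectation given `γ` has vanishing
integral over the events of `σ(γ)` on which it is integrable. -/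
lemma setIntegral_eq_zero_of_hasCondExp (hγ : Measurable γ) {X : Ω → ℝ}
    (hX : HasCondExp P (mβ.comap γ) X (fun _ => 0)) {C : Set β} (hC : MeasurableSet C)
    (hint : IntegrableOn X (γ ⁻¹' C) P) : ∫ ω in γ ⁻¹' C, X ω ∂P = 0 := by
  obtain ⟨A, hA, hmono, hcov, hAX⟩ := hX
  have hm : mβ.comap γ ≤ mΩ := hγ.comap_le
  -- The conditional expectation is known only on each `A n`, so the integral over `γ ⁻¹' C` is
  -- exhausted by those over `γ ⁻¹' C ∩ A n`, all zero.
  have hlim := tendsto_setIntegral_of_monotone (μ := P) (f := X) (s := fun n => γ ⁻¹' C ∩ A n)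
    (fun n => (hγ hC).inter (hm _ (hA n)))
    (fun i j hij => inter_subset_inter_right _ (hmono hij))
    (by rw [← inter_iUnion, hcov, inter_univ]; exact hint)
  rw [← inter_iUnion, hcov, inter_univ] at hlim
  refine tendsto_nhds_unique hlim (tendsto_const_nhds.congr fun n => ?_)
  obtain ⟨h1, h2⟩ := hAX n
  rw [← setIntegral_indicator (hm _ (hA n)), ← setIntegral_condExp hm
    ((integrable_indicator_iff (hm _ (hA n))).2 h1) ⟨C, hC, rfl⟩,
    setIntegral_congr_ae (g := fun _ => (0 : ℝ)) (hγ hC)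
      (h2.mono fun ω hω _ => hω.trans (by simp)), integral_zero]

end CondExp

/-! ### Condition M -/

section ConditionM

variable {ν : Measure ℝ≥0∞} {F H : ℝ≥0 → ℝ}

lemma MemL1loc.integrableOn_Ioc {z : ℝ≥0 → ℝ} (hz : MemL1loc ν z) {t : ℝ≥0}
    (ht : t ∈ timeSet ν) : IntegrableOn z (Ioc 0 t) (dG ν) :=
  (hz.2 t ht).mono_set Ioc_subset_Icc_self

lemma setIntegral_Ioc_eq_add {u : ℝ≥0} (hu : 0 < u) [IsFiniteMeasure ν]
    (hH : IntegrableOn H (Ioc 0 u) (dG ν)) :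
    ∫ x in Ioc 0 u, H x ∂(dG ν)
      = ∫ x in Ioo 0 u, H x ∂(dG ν) + (dG ν).real {u} * H u := by
  rw [← Ioo_union_right hu] at hH ⊢
  rw [setIntegral_union (by simp) (measurableSet_singleton u) hH.left_of_union
    hH.right_of_union, integral_singleton, smul_eq_mul]

variable [IsProbabilityMeasure ν]

lemma CaseB.dG_singleton_pos (h : CaseB ν) : 0 < (dG ν).real {(tG ν).toNNReal} := by
  rw [measureReal_def, dG_apply, image_singleton, ENNReal.coe_toNNReal h.1.ne]
  exact ENNReal.toReal_pos h.2.ne' (measure_ne_top _ _)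

lemma tendsto_Gbar_left {u : ℝ≥0} (hu : 0 < u) :
    Tendsto (Gbar ν) (𝓝[<] u) (𝓝 (Gbar ν u + (dG ν).real {u})) :=
  tendsto_left_of_sub_eq (fun _ _ => Gbar_sub_Gbar) hu

/-- The defining relation of Condition M holds on the whole time set. -/
lemma ConditionM.main_of_mem_timeSet (h : ConditionM ν F H) (h0 : 0 < Gbar ν 0) {t : ℝ≥0}
    (ht : t ∈ timeSet ν) :
    F t * Gbar ν t + ∫ x in Ioc 0 t, H x ∂(dG ν) = F 0 * Gbar ν 0 := by
  by_cases htG : (t : ℝ≥0∞) < tG ν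
  · exact h.main t htG
  obtain ⟨hB, heq⟩ := caseB_of_mem_timeSet ht htG
  have ht' : (tG ν).toNNReal = t := by rw [← heq, ENNReal.toNNReal_coe]
  have htpos : 0 < t := ENNReal.coe_pos.1 (by rw [heq]; exact tG_pos h0)
  have hG0 : Gbar ν t = 0 := by rw [← ht']; exact Gbar_tG hB.1
  have hlim := h.caseB hB
  rw [ht'] at hlim
  have hH := h.memL1loc.integrableOn_Ioc ht
  -- Let `s ↑ t_G` in the relation: the first term tends to `H(t_G)` times the atom, which is the
  -- part of the integral missing over the open interval. The value of `F` at `t_G` is multiplied by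
  -- zero.
  have h1 := (hlim.mul (tendsto_Gbar_left (ν := ν) htpos)).add
    (tendsto_setIntegral_Ioc_left le_rfl (hH.mono_set Ioo_subset_Ioc_self))
  have : (𝓝[<] t).NeBot := nhdsLT_neBot_of_exists_lt ⟨0, htpos⟩
  have h2 := tendsto_nhds_unique h1 (tendsto_const_nhds.congr' (by
    filter_upwards [self_mem_nhdsWithin] with s hs
    exact (h.main s (heq ▸ ENNReal.coe_lt_coe.2 hs)).symm))
  rw [setIntegral_Ioc_eq_add htpos hH, hG0, ← h2, hG0]
  ring

lemma measurable_setIntegral_Ioc (hH : Measurable H) :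
    Measurable fun t => ∫ x in Ioc 0 t, H x ∂(dG ν) := by
  have hs : MeasurableSet {p : ℝ≥0 × ℝ≥0 | 0 < p.2 ∧ p.2 ≤ p.1} :=
    (measurableSet_lt (measurable_const (a := (0 : ℝ≥0))) measurable_snd).inter
      (measurableSet_le (f := Prod.snd) (g := Prod.fst) measurable_snd measurable_fst)
  have h1 : StronglyMeasurable (Function.uncurry fun t x =>
      {p : ℝ≥0 × ℝ≥0 | 0 < p.2 ∧ p.2 ≤ p.1}.indicator (fun p => H p.2) (t, x)) :=
    ((hH.comp measurable_snd).indicator hs).stronglyMeasurable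
  have h2 := (h1.integral_prod_right (ν := dG ν)).measurable
  convert h2 using 2 with t
  rw [← integral_indicator measurableSet_Ioc]
  rfl

/-- Condition M follows from its defining relation on the whole time set. -/
lemma conditionM_of_main (hH : Measurable H) (hHi : MemL1loc ν H) (h0 : 0 < Gbar ν 0)
    (hmain : ∀ t ∈ timeSet ν,
      F t * Gbar ν t + ∫ x in Ioc 0 t, H x ∂(dG ν) = F 0 * Gbar ν 0) :
    ConditionM ν F H where
  memL1loc := hHi
  main t ht := hmain t (mem_timeSet_of_lt_tG ht)
  caseB hB := by
    set u := (tG ν).toNNReal with hu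
    have huT : u ∈ timeSet ν := toNNReal_tG_mem_timeSet hB
    have hucoe : (u : ℝ≥0∞) = tG ν := ENNReal.coe_toNNReal hB.1.ne
    have hupos : 0 < u := ENNReal.coe_pos.1 (by rw [hucoe]; exact tG_pos h0)
    have hG0 : Gbar ν u = 0 := Gbar_tG hB.1
    have hHu := hHi.integrableOn_Ioc huT
    have hatom := hB.dG_singleton_pos
    rw [← hu] at hatom
    have h1 := ((tendsto_const_nhds (x := F 0 * Gbar ν 0)).sub
      (tendsto_setIntegral_Ioc_left le_rfl (hHu.mono_set Ioo_subset_Ioc_self))).div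
      (tendsto_Gbar_left (ν := ν) hupos) (by rw [hG0, zero_add]; exact hatom.ne')
    have h2 := hmain u huT
    rw [hG0, mul_zero, zero_add, setIntegral_Ioc_eq_add hupos hHu] at h2
    rw [← h2, hG0, zero_add, add_sub_cancel_left, mul_div_cancel_left₀ _ hatom.ne'] at h1
    refine h1.congr' ?_
    filter_upwards [self_mem_nhdsWithin] with s hs
    have hs' : (s : ℝ≥0∞) < tG ν := hucoe ▸ ENNReal.coe_lt_coe.2 hs
    rw [Pi.div_apply, div_eq_iff (Gbar_pos_of_lt_tG hs').ne', h2,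
      ← hmain s (mem_timeSet_of_lt_tG hs'), add_sub_cancel_right]
  locallyAC := by
    set C := F 0 * Gbar ν 0 with hC
    set X : ℝ≥0 → ℝ := fun t => C - ∫ x in Ioc 0 t, H x ∂(dG ν) with hX
    have hXm : Measurable X := measurable_const.sub (measurable_setIntegral_Ioc hH)
    have hGm : Measurable (Gbar ν) := Gbar_antitone.measurable
    have hIm : Measurable fun t : ℝ≥0 => ν.real (Ici (t : ℝ≥0∞)) :=
      Antitone.measurable fun a b hab =>
        measureReal_mono (Ici_subset_Ici.2 (ENNReal.coe_le_coe.2 hab))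
    -- The density is `(F - H)` over the left limit of the survival function. `F` is written as `X /
    -- Gbar`, which makes `z` visibly Borel; the indicator removes the points where `Gbar` vanishes.
    set z : ℝ≥0 → ℝ := {t | 0 < Gbar ν t}.indicator
      (fun t => (X t / Gbar ν t - H t) / ν.real (Ici (t : ℝ≥0∞))) with hz
    have hzm : Measurable z :=
      (((hXm.div hGm).sub hH).div hIm).indicator (measurableSet_lt measurable_const hGm)
    refine ⟨z, ⟨hzm.comp measurable_subtype_coe, fun t ht => ?_⟩, fun t ht => ?_⟩
    · have hHt := hHi.2 t ht
      have hd : 0 < ν.real (Ici (t : ℝ≥0∞)) :=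
        ENNReal.toReal_pos (show 0 < ν (Ici (t : ℝ≥0∞)) from ht).ne' (measure_ne_top _ _)
      -- If `Gbar ν t = 0`, as at `t_G` in Case B, every `s` with `Gbar ν s > 0` lies strictly below
      -- `t`, so the mass of `[t, ∞]` is a lower bound.
      obtain ⟨c, hc, hcG⟩ : ∃ c > 0, ∀ s ≤ t, 0 < Gbar ν s → c ≤ Gbar ν s := by
        by_cases hGt : 0 < Gbar ν t
        · exact ⟨_, hGt, fun s hs _ => Gbar_antitone hs⟩
        · refine ⟨_, hd, fun s hs hGs => ?_⟩
          have hst : s < t := lt_of_le_of_ne hs (by rintro rfl; exact hGt hGs)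
          rw [Gbar_eq]
          exact measureReal_mono (Ici_subset_Ioi.2 (ENNReal.coe_lt_coe.2 hst))
      set K := |C| + ∫ x in Icc 0 t, ‖H x‖ ∂(dG ν) with hK
      have hK0 : 0 ≤ K := add_nonneg (abs_nonneg _) (integral_nonneg fun _ => norm_nonneg _)
      have hXK : ∀ s ≤ t, |X s| ≤ K := fun s hs => by
        refine (abs_sub _ _).trans (add_le_add_right ?_ _)
        exact (norm_integral_le_integral_norm _).trans
          (setIntegral_mono_set hHt.norm (Eventually.of_forall fun _ => norm_nonneg _)
            (Ioc_subset_Icc_self.trans (Icc_subset_Icc_right hs)).eventuallyLE)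
      refine Integrable.mono' (g := fun x => (K / c + ‖H x‖) / ν.real (Ici (t : ℝ≥0∞)))
        (((integrable_const _).add hHt.norm).div_const _) hzm.aestronglyMeasurable ?_
      filter_upwards [ae_restrict_mem measurableSet_Icc] with s hs
      by_cases hGs : 0 < Gbar ν s
      · rw [hz, indicator_of_mem (show s ∈ {t | 0 < Gbar ν t} from hGs), norm_div,
          Real.norm_of_nonneg (r := ν.real _) measureReal_nonneg]
        gcongr
        · refine (norm_sub_le _ _).trans (add_le_add_left ?_ _)
          rw [norm_div, Real.norm_of_nonneg (r := Gbar ν s) hGs.le]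
          have := hXK s hs.2
          have := hcG s hs.2 hGs
          gcongr
          exact hXK s hs.2
        · simp
        · exact hs.2
      · rw [hz, indicator_of_notMem (show s ∉ {t | 0 < Gbar ν t} from hGs), norm_zero]
        positivity
    · have htT := mem_timeSet_of_lt_tG ht
      have hGt := Gbar_pos_of_lt_tG ht
      rw [eq_add_setIntegral_of_mul_add_eq (μ := dG ν) (g := Gbar ν) (F := F) (H := H) (C := C)
        (fun a b => Gbar_sub_Gbar) hGt (hHi.integrableOn_Ioc htT)
        fun s hs => hmain s (mem_timeSet_of_le hs htT)]
      congr 1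
      refine setIntegral_congr_fun measurableSet_Ioc fun x hx => ?_
      have hGx : 0 < Gbar ν x := hGt.trans_le (Gbar_antitone hx.2)
      have hXx : X x = F x * Gbar ν x :=
        sub_eq_iff_eq_add.2 (hmain x (mem_timeSet_of_le hx.2 htT)).symm
      rw [hz, indicator_of_mem (show x ∈ {t | 0 < Gbar ν t} from hGx),
        Gbar_add_measureReal_singleton, hXx, mul_div_cancel_right₀ _ hGx.ne']

/-- A function which is locally absolutely continuous with respect to `G` has left limits at
points of `(0, t_G)`. -/
lemma LocallyAC.exists_tendsto_left (h : LocallyAC ν F) {t : ℝ≥0} (ht : (t : ℝ≥0∞) < tG ν) :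
    ∃ l : ℝ, Tendsto F (𝓝[<] t) (𝓝 l) := by
  obtain ⟨z, hz, hF⟩ := h
  have h1 := (tendsto_const_nhds (x := F 0)).add (tendsto_setIntegral_Ioc_left le_rfl
    ((hz.integrableOn_Ioc (mem_timeSet_of_lt_tG ht)).mono_set Ioo_subset_Ioc_self))
  refine ⟨_, h1.congr' ?_⟩
  filter_upwards [self_mem_nhdsWithin] with s hs
  exact (hF s ((ENNReal.coe_lt_coe.2 hs).trans ht)).symm

end ConditionM

/-! ### Processes with a single jump -/

section JumpProcess

variable {Ω : Type*} [mΩ : MeasurableSpace Ω] {P : Measure Ω} [IsProbabilityMeasure P]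
  {γ : Ω → ℝ≥0∞} {F : ℝ≥0 → ℝ} {L : Ω → ℝ} {s t : ℝ≥0} {ω : Ω} {M : ℝ≥0 → Ω → ℝ}

omit mΩ in
lemma jumpProcess_of_lt (h : (t : ℝ≥0∞) < γ ω) : jumpProcess γ F L t ω = F t := by
  rw [jumpProcess, indicator_of_mem (by exact h), indicator_of_notMem (by simpa using h), add_zero]

omit mΩ in
lemma jumpProcess_of_le (h : γ ω ≤ (t : ℝ≥0∞)) : jumpProcess γ F L t ω = L ω := by
  rw [jumpProcess, indicator_of_notMem (by simpa using h), indicator_of_mem (by exact h), zero_add]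

lemma measureReal_preimage_Ioi (hγ : Measurable γ) (t : ℝ≥0) :
    P.real (γ ⁻¹' Ioi (t : ℝ≥0∞)) = Gbar (P.map γ) t := by
  have := Measure.isProbabilityMeasure_map (μ := P) hγ.aemeasurable
  rw [Gbar_eq, map_measureReal_apply hγ measurableSet_Ioi]

lemma integrable_of_ae_eq_jumpProcess (hγ : Measurable γ) (hM : M t =ᵐ[P] jumpProcess γ F L t)
    (hL : IntegrableOn L (γ ⁻¹' Iic (t : ℝ≥0∞)) P) : Integrable (M t) P := by
  refine Integrable.congr ?_ hM.symm
  exact ((integrable_const (F t)).indicator (hγ measurableSet_Ioi)).add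
    ((integrable_indicator_iff (hγ measurableSet_Iic)).2 hL)

lemma setIntegral_preimage_Ioi (hγ : Measurable γ) (hM : M t =ᵐ[P] jumpProcess γ F L t)
    (hL : IntegrableOn L (γ ⁻¹' Iic (t : ℝ≥0∞)) P) (hst : s ≤ t) :
    ∫ ω in γ ⁻¹' Ioi (s : ℝ≥0∞), M t ω ∂P
      = F t * Gbar (P.map γ) t + ∫ ω in γ ⁻¹' Ioc (s : ℝ≥0∞) t, L ω ∂P := by
  have hMi := integrable_of_ae_eq_jumpProcess hγ hM hL
  rw [← Ioc_union_Ioi_eq_Ioi (ENNReal.coe_le_coe.2 hst), preimage_union,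
    setIntegral_union ((Ioc_disjoint_Ioi le_rfl).preimage γ) (hγ measurableSet_Ioi)
      hMi.integrableOn hMi.integrableOn, add_comm]
  congr 1
  · rw [setIntegral_congr_ae (g := fun _ => F t) (hγ measurableSet_Ioi)
      (hM.mono fun ω hω h => hω.trans (jumpProcess_of_lt h)), setIntegral_const, smul_eq_mul,
      measureReal_preimage_Ioi hγ, mul_comm]
  · exact setIntegral_congr_ae (hγ measurableSet_Ioc)
      (hM.mono fun ω hω h => hω.trans (jumpProcess_of_le h.2))

/-- A criterion for the martingale property between two times of a single jump process. -/
lemma condExp_eq_of_jumpProcess (hγ : Measurable γ) (hadp : Adapted (filtration γ) M)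
    (hMs : M s =ᵐ[P] jumpProcess γ F L s) (hMt : M t =ᵐ[P] jumpProcess γ F L t)
    (hL : IntegrableOn L (γ ⁻¹' Iic (t : ℝ≥0∞)) P) (hst : s ≤ t)
    (hmain : F t * Gbar (P.map γ) t + ∫ ω in γ ⁻¹' Ioc (s : ℝ≥0∞) t, L ω ∂P
      = F s * Gbar (P.map γ) s) :
    P[M t | filtration γ s] =ᵐ[P] M s := by
  have hLs : IntegrableOn L (γ ⁻¹' Iic (s : ℝ≥0∞)) P :=
    hL.mono_set (preimage_mono (Iic_subset_Iic.2 (ENNReal.coe_le_coe.2 hst)))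
  have hit := integrable_of_ae_eq_jumpProcess hγ hMt hL
  have his := integrable_of_ae_eq_jumpProcess hγ hMs hLs
  have hQ : MeasurableSet (γ ⁻¹' Iic (s : ℝ≥0∞)) := hγ measurableSet_Iic
  refine (ae_eq_condExp_of_forall_setIntegral_eq ((filtration γ).le s) hit
    (fun _ _ _ => his.integrableOn) (fun A hA _ => ?_)
    (hadp s).stronglyMeasurable.aestronglyMeasurable).symm
  rw [← integral_inter_add_sdiff hQ his.integrableOn,
    ← integral_inter_add_sdiff hQ hit.integrableOn]
  have hA' := measurableSet_filtration_iff.1 hA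
  congr 1
  · refine setIntegral_congr_ae (hA'.1.inter hQ) ?_
    filter_upwards [hMs, hMt] with ω h1 h2 h
    rw [h1, h2, jumpProcess_of_le h.2,
      jumpProcess_of_le (le_trans h.2 (ENNReal.coe_le_coe.2 hst))]
  · have e : A \ (γ ⁻¹' Iic (s : ℝ≥0∞)) = A ∩ {ω | (s : ℝ≥0∞) < γ ω} := by
      ext ω; simp
    rw [e]
    rcases hA'.2 with h | h
    · rw [h]; simp
    · rw [h]
      have h1 := setIntegral_preimage_Ioi hγ hMt hL hst
      have h2 := setIntegral_preimage_Ioi hγ hMs hLs le_rfl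
      rw [hmain] at h1
      rw [Ioc_self, preimage_empty, setIntegral_empty, add_zero] at h2
      exact h2.trans h1.symm

end JumpProcess

/-! ### From Condition M to local martingales -/

section Sufficiency

variable {Ω : Type*} [mΩ : MeasurableSpace Ω] {P : Measure Ω} [IsProbabilityMeasure P]
  {γ : Ω → ℝ≥0∞} {F H : ℝ≥0 → ℝ} {L L' : Ω → ℝ} {s t : ℝ≥0} {M : ℝ≥0 → Ω → ℝ}

omit [IsProbabilityMeasure P] in
-- Together with `coe_mem_timeSet_of_le` this says that almost surely every finite time up to `γ`
-- belongs to `𝒯`.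
lemma ae_measure_map_Ici_pos (hγ : Measurable γ) : ∀ᵐ ω ∂P, 0 < P.map γ (Ici (γ ω)) :=
  ae_of_ae_map hγ.aemeasurable (ae_measure_Ici_pos (P.map γ))

lemma coe_mem_timeSet_of_le {x : ℝ≥0∞} {ν : Measure ℝ≥0∞} (hx : 0 < ν (Ici x))
    (ht : (t : ℝ≥0∞) ≤ x) : t ∈ timeSet ν :=
  lt_of_lt_of_le hx (measure_mono (Ici_subset_Ici.2 ht))

lemma Gbar_zero_pos (hγ : Measurable γ) (hγ0 : 0 < P {ω | 0 < γ ω}) : 0 < Gbar (P.map γ) 0 := by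
  rw [← measureReal_preimage_Ioi hγ]
  exact ENNReal.toReal_pos (by simpa [preimage, Ioi] using hγ0.ne') (measure_ne_top _ _)

lemma zero_mem_timeSet (hγ : Measurable γ) (hγ0 : 0 < P {ω | 0 < γ ω}) :
    0 ∈ timeSet (P.map γ) := by
  have := Measure.isProbabilityMeasure_map (μ := P) hγ.aemeasurable
  exact mem_timeSet_of_lt_tG (tG_pos (Gbar_zero_pos hγ hγ0))

/-- Left limits are clear after the jump. At `t ≤ γ` they are those of `F`; almost surely such `t`
is in `𝒯`, so absolute continuity applies below `t_G` and the Case B clause at `t_G`. -/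
lemma isCadlag_of_conditionM (hF : ConditionM (P.map γ) F H) (hγ : Measurable γ)
    (hMr : ∀ᵐ ω ∂P, ∀ t : ℝ≥0, ContinuousWithinAt (fun s => M s ω) (Ici t) t)
    (hM : ∀ᵐ ω ∂P, ∀ t : ℝ≥0, M t ω = jumpProcess γ F L t ω) :
    ∀ᵐ ω ∂P, IsCadlag (fun t => M t ω) := by
  have := Measure.isProbabilityMeasure_map (μ := P) hγ.aemeasurable
  filter_upwards [hMr, hM, ae_measure_map_Ici_pos hγ] with ω h1 h2 h3
  refine ⟨h1, fun t ht => ?_⟩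
  rcases lt_or_ge (γ ω) (t : ℝ≥0∞) with h | h
  · lift γ ω to ℝ≥0 using (h.trans ENNReal.coe_lt_top).ne with g hg
    refine ⟨L ω, tendsto_const_nhds.congr' ?_⟩
    filter_upwards [mem_nhdsWithin_of_mem_nhds (Ioi_mem_nhds (ENNReal.coe_lt_coe.1 h))] with s hs
    rw [h2, jumpProcess_of_le]
    rw [← hg]
    exact (ENNReal.coe_lt_coe.2 hs).le
  · obtain ⟨l, hl⟩ : ∃ l : ℝ, Tendsto F (𝓝[<] t) (𝓝 l) := by
      by_cases htG : (t : ℝ≥0∞) < tG (P.map γ)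
      · exact hF.locallyAC.exists_tendsto_left htG
      · obtain ⟨hB, heq⟩ := caseB_of_mem_timeSet (coe_mem_timeSet_of_le h3 h) htG
        have h4 := hF.caseB hB
        rw [← heq, ENNReal.toNNReal_coe] at h4
        exact ⟨_, h4⟩
    refine ⟨l, hl.congr' ?_⟩
    filter_upwards [self_mem_nhdsWithin] with s hs
    rw [h2, jumpProcess_of_lt ((ENNReal.coe_lt_coe.2 hs).trans_le h)]

/-- The time `u` before the jump, and `∞` from the jump on. -/
noncomputable def preJumpTime (γ : Ω → ℝ≥0∞) (u : ℝ≥0) (ω : Ω) : WithTop ℝ≥0 :=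
  open Classical in if γ ω ≤ u then ⊤ else u

omit mΩ in
lemma le_preJumpTime (u : ℝ≥0) (ω : Ω) : (u : WithTop ℝ≥0) ≤ preJumpTime γ u ω := by
  unfold preJumpTime
  split_ifs
  exacts [le_top, le_rfl]

lemma isStoppingTime_preJumpTime (hγ : Measurable γ) (u : ℝ≥0) :
    IsStoppingTime (filtration γ) (preJumpTime γ u) := by
  intro i
  by_cases hui : u ≤ i
  · have e : {ω | preJumpTime γ u ω ≤ i} = {ω | γ ω ≤ u}ᶜ := by
      ext ω
      simp only [preJumpTime, mem_ofPred_eq, mem_compl_iff]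
      split_ifs with h
      · exact iff_of_false (WithTop.not_top_le_coe i) (not_not.2 h)
      · exact iff_of_true (WithTop.coe_le_coe.2 hui) h
    rw [e]
    exact MeasurableSet.compl (measurableSet_filtration_le hγ hui)
  · have e : {ω | preJumpTime γ u ω ≤ i} = ∅ := by
      ext ω
      simp only [mem_ofPred_eq, mem_empty_iff_false, iff_false]
      exact fun h => hui (WithTop.coe_le_coe.1 ((le_preJumpTime u ω).trans h))
    rw [e]
    exact @MeasurableSet.empty _ (filtration γ i)

omit [IsProbabilityMeasure P] in
-- The `u n` may stay bounded, but almost surely a finite `γ` is eventually at most `u n`, and the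
-- time is then `∞`; if `γ = ∞` has positive probability, `𝒯` is all of `[0, ∞)`.
lemma isLocalizingSequence_preJumpTime (hγ : Measurable γ) {u : ℕ → ℝ≥0} (hu : Monotone u)
    (hcof : ∀ t ∈ timeSet (P.map γ), ∀ᶠ n in atTop, t ≤ u n) :
    IsLocalizingSequence (filtration γ) (fun n => preJumpTime γ (u n)) P where
  isStoppingTime n := isStoppingTime_preJumpTime hγ (u n)
  mono := Eventually.of_forall fun ω i j hij => by
    have h := hu hij
    dsimp only [preJumpTime]
    split_ifs with h1 h2 h2
    · exact le_rfl
    · exact absurd (h1.trans (ENNReal.coe_le_coe.2 h)) h2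
    · exact le_top
    · exact WithTop.coe_le_coe.2 h
  tendsto_top := by
    filter_upwards [ae_measure_map_Ici_pos hγ] with ω hω
    refine tendsto_order.2 ⟨fun a ha => ?_, fun a ha => absurd ha not_top_lt⟩
    lift a to ℝ≥0 using ha.ne
    by_cases hγω : γ ω = ∞
    · filter_upwards [hcof (a + 1) (coe_mem_timeSet_of_le hω (by simp [hγω]))] with n hn
      exact (WithTop.coe_lt_coe.2 ((lt_add_one a).trans_le hn)).trans_le (le_preJumpTime _ _)
    · have hmem : (γ ω).toNNReal ∈ timeSet (P.map γ) :=
        coe_mem_timeSet_of_le hω ENNReal.coe_toNNReal_le_self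
      filter_upwards [hcof _ hmem] with n hn
      rw [preJumpTime, if_pos]
      · exact ha
      · rw [← ENNReal.coe_toNNReal hγω]
        exact ENNReal.coe_le_coe.2 hn

omit mΩ in
lemma stoppedProcess_preJumpTime_of_le {u : ℝ≥0} {ω : Ω} (h : γ ω ≤ u) :
    stoppedProcess M (preJumpTime γ u) t ω = M t ω :=
  stoppedProcess_eq_of_le (by rw [preJumpTime, if_pos h]; exact le_top)

omit mΩ in
lemma stoppedProcess_preJumpTime_of_lt {u : ℝ≥0} {ω : Ω} (h : (u : ℝ≥0∞) < γ ω) :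
    stoppedProcess M (preJumpTime γ u) t ω = M (min t u) ω := by
  rw [stoppedProcess, preJumpTime, if_neg (not_le.2 h), ← WithTop.coe_min]
  rfl

/-- No path regularity is needed: from time `u` on, the stopped process is `M t` on `{γ ≤ u}` and `M
u` elsewhere. -/
lemma stronglyAdapted_stoppedProcess_preJumpTime (hγ : Measurable γ)
    (hadp : Adapted (filtration γ) M) (u : ℝ≥0) :
    StronglyAdapted (filtration γ) (stoppedProcess M (preJumpTime γ u)) := by
  classical
  intro t
  rcases le_total t u with htu | hut
  · have e : stoppedProcess M (preJumpTime γ u) t = M t := funext fun ω =>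
      stoppedProcess_eq_of_le ((WithTop.coe_le_coe.2 htu).trans (le_preJumpTime u ω))
    rw [e]
    exact (hadp t).stronglyMeasurable
  · have e : stoppedProcess M (preJumpTime γ u) t = {ω | γ ω ≤ u}.piecewise (M t) (M u) := by
      funext ω
      by_cases h : γ ω ≤ u
      · rw [piecewise_eq_of_mem _ _ _ (by exact h), stoppedProcess_preJumpTime_of_le h]
      · rw [piecewise_eq_of_notMem _ _ _ (by exact h),
          stoppedProcess_preJumpTime_of_lt (not_le.1 h), min_eq_right hut]
    rw [e]
    exact ((hadp t).piecewise (measurableSet_filtration_le hγ hut)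
      ((hadp u).mono ((filtration γ).mono hut) le_rfl)).stronglyMeasurable

/-- A single jump process which satisfies the martingale property on `[0, u]` is a uniformly
integrable martingale once stopped at `u` before its jump. -/
lemma martingale_stoppedProcess_preJumpTime (hγ : Measurable γ)
    (hadp : Adapted (filtration γ) M) {u : ℝ≥0}
    (hM : ∀ᵐ ω ∂P, ∀ t : ℝ≥0, M t ω = jumpProcess γ F L t ω) (hint : Integrable (M u) P)
    (hmart : ∀ t ≤ u, P[M u | filtration γ t] =ᵐ[P] M t) :
    Martingale (stoppedProcess M (preJumpTime γ u)) (filtration γ) P ∧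
      UniformIntegrable (stoppedProcess M (preJumpTime γ u)) 1 P := by
  -- The stopped process is closed by `M u`; uniform integrability follows.
  have key : ∀ t, P[M u | filtration γ t] =ᵐ[P] stoppedProcess M (preJumpTime γ u) t := by
    intro t
    rcases le_total t u with htu | hut
    · refine (hmart t htu).trans (Eventually.of_forall fun ω => ?_)
      exact (stoppedProcess_eq_of_le
        ((WithTop.coe_le_coe.2 htu).trans (le_preJumpTime u ω))).symm
    · rw [condExp_of_stronglyMeasurable ((filtration γ).le t)
        (((hadp u).mono ((filtration γ).mono hut) le_rfl).stronglyMeasurable) hint]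
      filter_upwards [hM] with ω hω
      rcases le_or_gt (γ ω) u with h | h
      · rw [stoppedProcess_preJumpTime_of_le h, hω, hω, jumpProcess_of_le h,
          jumpProcess_of_le (h.trans (ENNReal.coe_le_coe.2 hut))]
      · rw [stoppedProcess_preJumpTime_of_lt h, min_eq_right hut]
  exact ⟨(martingale_condExp (M u) (filtration γ) P).congr
    (stronglyAdapted_stoppedProcess_preJumpTime hγ hadp u) key,
    (hint.uniformIntegrable_condExp (filtration γ).le).ae_eq key⟩

theorem isLocalMartingale_of_conditionM (hγ : Measurable γ) (hγ0 : 0 < P {ω | 0 < γ ω})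
    (hadp : Adapted (filtration γ) M)
    (hMr : ∀ᵐ ω ∂P, ∀ t : ℝ≥0, ContinuousWithinAt (fun s => M s ω) (Ici t) t)
    (hF : ConditionM (P.map γ) F H)
    (hL' : ∀ t ∈ timeSet (P.map γ), IntegrableOn L' {ω | γ ω ≤ (t : ℝ≥0∞)} P)
    (hL'0 : HasCondExp P (MeasurableSpace.comap γ inferInstance) L' (fun _ => 0))
    (hM : ∀ᵐ ω ∂P, ∀ t : ℝ≥0,
      M t ω = jumpProcess γ F (fun ω' => H (γ ω').toNNReal + L' ω') t ω) :
    IsLocalMartingale M (filtration γ) P := by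
  have := Measure.isProbabilityMeasure_map (μ := P) hγ.aemeasurable
  refine ⟨hadp, isCadlag_of_conditionM hF hγ hMr hM, ?_⟩
  obtain ⟨u, hu, huT, hcof⟩ := exists_monotone_cofinal_timeSet (zero_mem_timeSet hγ hγ0)
  refine ⟨_, isLocalizingSequence_preJumpTime hγ hu hcof, fun n => ?_⟩
  have hH : IntegrableOn (fun ω => H (γ ω).toNNReal) (γ ⁻¹' Iic (u n : ℝ≥0∞)) P := by
    rw [← image_coe_Icc_zero]
    exact integrableOn_dG_map hγ measurableSet_Icc (hF.memL1loc.2 _ (huT n))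
  have hL'n : IntegrableOn L' (γ ⁻¹' Iic (u n : ℝ≥0∞)) P := hL' _ (huT n)
  have hL : IntegrableOn (fun ω' => H (γ ω').toNNReal + L' ω') (γ ⁻¹' Iic (u n : ℝ≥0∞)) P :=
    hH.add hL'n
  have hMt : ∀ t, M t =ᵐ[P] jumpProcess γ F (fun ω' => H (γ ω').toNNReal + L' ω') t := fun t =>
    hM.mono fun ω hω => hω t
  refine martingale_stoppedProcess_preJumpTime hγ hadp hM
    (integrable_of_ae_eq_jumpProcess hγ (hMt _) hL) fun t ht => ?_
  refine condExp_eq_of_jumpProcess hγ hadp (hMt t) (hMt (u n)) hL ht ?_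
  have hsub : γ ⁻¹' Ioc (t : ℝ≥0∞) (u n) ⊆ γ ⁻¹' Iic (u n : ℝ≥0∞) :=
    preimage_mono Ioc_subset_Iic_self
  have hHu := hF.memL1loc.integrableOn_Ioc (huT n)
  rw [integral_add (hH.mono_set hsub) (hL'n.mono_set hsub),
    setIntegral_eq_zero_of_hasCondExp hγ hL'0 measurableSet_Ioc (hL'n.mono_set hsub), add_zero,
    ← image_coe_Ioc, ← setIntegral_dG_map hγ measurableSet_Ioc
      (hHu.mono_set (Ioc_subset_Ioc_left zero_le))]
  -- `L'` has dropped out; the remaining identity is the relation at `u n` minus the relation at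
  -- `t`.
  have h1 := hF.main_of_mem_timeSet (Gbar_zero_pos hγ hγ0) (huT n)
  rw [← hF.main_of_mem_timeSet (Gbar_zero_pos hγ hγ0) (mem_timeSet_of_le ht (huT n)),
    ← Ioc_union_Ioc_eq_Ioc zero_le ht,
    setIntegral_union (Ioc_disjoint_Ioc_of_le le_rfl) measurableSet_Ioc
      (hHu.mono_set (Ioc_subset_Ioc_right ht))
      (hHu.mono_set (Ioc_subset_Ioc_left zero_le))] at h1
  linarith

end Sufficiency

/-! ### From local martingales to Condition M -/

section Necessity

variable {Ω : Type*} [mΩ : MeasurableSpace Ω] {P : Measure Ω} [IsProbabilityMeasure P]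
  {γ : Ω → ℝ≥0∞} {s t : ℝ≥0} {M : ℝ≥0 → Ω → ℝ}

/-- Martingales of the single jump filtration are constant after the jump. -/
lemma ae_eq_of_le_of_martingale (hγ : Measurable γ) {X : ℝ≥0 → Ω → ℝ}
    (hX : Martingale X (filtration γ) P) (hst : s ≤ t) :
    ∀ᵐ ω ∂P, γ ω ≤ (s : ℝ≥0∞) → X t ω = X s ω := by
  have hXm : Measurable (X t) := ((hX.stronglyMeasurable t).mono ((filtration γ).le t)).measurable
  have hA : MeasurableSet[filtration γ s] {ω | γ ω ≤ (s : ℝ≥0∞)} :=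
    measurableSet_filtration_le hγ le_rfl
  -- After multiplication by the indicator of `{γ ≤ s}`, `X t` is already measurable at time `s`,
  -- hence is its own conditional expectation.
  have h1 := condExp_indicator (m := filtration γ s) (hX.integrable t) hA
  rw [condExp_of_stronglyMeasurable ((filtration γ).le s)
    (measurable_filtration_indicator hγ hXm).stronglyMeasurable
    ((hX.integrable t).indicator ((filtration γ).le s _ hA))] at h1
  filter_upwards [h1, hX.condExp_ae_eq hst] with ω h2 h3 h
  rw [indicator_of_mem (by exact h), indicator_of_mem (by exact h), h3] at h2
  exact h2

/-- Local martingales of the single jump filtration are constant after the jump. -/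
lemma IsLocalMartingale.exists_eq_of_le (hγ : Measurable γ)
    (hM : IsLocalMartingale M (filtration γ) P) :
    ∃ L : Ω → ℝ, Measurable L ∧
      ∀ᵐ ω ∂P, ∀ t : ℝ≥0, γ ω ≤ (t : ℝ≥0∞) → M t ω = L ω := by
  obtain ⟨τ, hτ, hmart⟩ := hM.localizing
  obtain ⟨D, hDc, hD⟩ := TopologicalSpace.exists_countable_dense ℝ≥0
  have hcD := hDc.to_subtype
  have h1 : ∀ᵐ ω ∂P, ∀ (n : ℕ) (a b : D), (a : ℝ≥0) ≤ b → γ ω ≤ ((a : ℝ≥0) : ℝ≥0∞) →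
      stoppedProcess M (τ n) b ω = stoppedProcess M (τ n) a ω := by
    refine ae_all_iff.2 fun n => ae_all_iff.2 fun a => ae_all_iff.2 fun b => ?_
    by_cases hab : (a : ℝ≥0) ≤ b
    · filter_upwards [ae_eq_of_le_of_martingale hγ (hmart n).1 hab] with ω hω _
      exact hω
    · exact Eventually.of_forall fun _ h => absurd h hab
  have h2 : ∀ᵐ ω ∂P, ∀ a b : ℝ≥0, γ ω ≤ (a : ℝ≥0∞) → γ ω ≤ (b : ℝ≥0∞) → M a ω = M b ω := by
    filter_upwards [h1, hτ.tendsto_top, hM.cadlag] with ω h3 h4 h5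
    have hDle : ∀ a ∈ D, ∀ b ∈ D, a ≤ b → γ ω ≤ (a : ℝ≥0∞) → M b ω = M a ω := by
      intro a ha b hb hab hγa
      obtain ⟨n, hn⟩ := (h4.eventually (lt_mem_nhds (WithTop.coe_lt_top b))).exists
      have := h3 n ⟨a, ha⟩ ⟨b, hb⟩ hab hγa
      rwa [stoppedProcess_eq_of_le hn.le,
        stoppedProcess_eq_of_le ((WithTop.coe_le_coe.2 hab).trans hn.le)] at this
    -- Right-continuity carries constancy from the countable dense set to all times, keeping a
    -- single null set.
    have key : ∀ a : ℝ≥0, γ ω ≤ (a : ℝ≥0∞) → ∀ d ∈ D, a < d → M a ω = M d ω := by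
      intro a hγa d hd had
      have hne : (𝓝[Ioi a ∩ D] a).NeBot := by
        rw [← mem_closure_iff_nhdsWithin_neBot]
        have h6 : closure (Ioi a) ⊆ closure (Ioi a ∩ D) :=
          closure_minimal (hD.open_subset_closure_inter isOpen_Ioi) isClosed_closure
        rw [closure_Ioi] at h6
        exact h6 self_mem_Ici
      have hlim : Tendsto (fun s => M s ω) (𝓝[Ioi a ∩ D] a) (𝓝 (M a ω)) :=
        (h5.1 a).mono (inter_subset_left.trans Ioi_subset_Ici_self)
      refine tendsto_nhds_unique hlim (tendsto_const_nhds.congr' ?_)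
      filter_upwards [self_mem_nhdsWithin, mem_nhdsWithin_of_mem_nhds (Iio_mem_nhds had)]
        with c hc hcd
      exact hDle c hc.2 d hd (mem_Iio.1 hcd).le (hγa.trans (ENNReal.coe_le_coe.2 hc.1.le))
    intro a b ha hb
    obtain ⟨d, hd, hdlt⟩ := hD.exists_gt (max a b)
    rw [key a ha d hd ((le_max_left _ _).trans_lt hdlt),
      key b hb d hd ((le_max_right _ _).trans_lt hdlt)]
  have hmeas : ∀ t, Measurable (M t) := fun t =>
    (hM.adapted t).mono ((filtration γ).le t) le_rfl
  -- `L` is a limit along integer times, so that `M` is never evaluated at the random time `γ` in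
  -- proving measurability.
  obtain ⟨L, hL, hLlim⟩ := measurable_limit_of_tendsto_metrizable_ae (μ := P) (L := atTop)
    (f := fun (n : ℕ) => {ω | γ ω ≤ ((n : ℝ≥0) : ℝ≥0∞)}.indicator (M n))
    (fun n => ((hmeas n).indicator (measurableSet_le hγ measurable_const)).aemeasurable) (by
      filter_upwards [h2] with ω hω
      by_cases hγω : γ ω = ∞
      · refine ⟨0, tendsto_const_nhds.congr fun n => ?_⟩
        rw [indicator_of_notMem (by simp [hγω])]
      · refine ⟨M (γ ω).toNNReal ω, tendsto_const_nhds.congr' ?_⟩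
        obtain ⟨N, hN⟩ := exists_nat_ge (γ ω).toNNReal
        filter_upwards [eventually_ge_atTop N] with n hn
        have hle : γ ω ≤ ((n : ℝ≥0) : ℝ≥0∞) := by
          rw [← ENNReal.coe_toNNReal hγω]
          exact ENNReal.coe_le_coe.2 (hN.trans (Nat.cast_le.2 hn))
        rw [indicator_of_mem (by exact hle)]
        exact hω _ _ (ENNReal.coe_toNNReal hγω).ge hle)
  refine ⟨L, hL, ?_⟩
  filter_upwards [h2, hLlim] with ω h3 h4 t ht
  refine tendsto_nhds_unique (tendsto_const_nhds.congr' ?_) h4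
  obtain ⟨N, hN⟩ := exists_nat_ge t
  filter_upwards [eventually_ge_atTop N] with n hn
  have hle : γ ω ≤ ((n : ℝ≥0) : ℝ≥0∞) :=
    ht.trans (ENNReal.coe_le_coe.2 (hN.trans (Nat.cast_le.2 hn)))
  rw [indicator_of_mem (by exact hle)]
  exact h3 _ _ ht hle

omit [IsProbabilityMeasure P] in
/-- An adapted process which is constant after the jump is a single jump process. -/
lemma exists_ae_eq_jumpProcess (hadp : Adapted (filtration γ) M) {L : Ω → ℝ}
    (hL : ∀ᵐ ω ∂P, ∀ t : ℝ≥0, γ ω ≤ (t : ℝ≥0∞) → M t ω = L ω) :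
    ∃ F : ℝ≥0 → ℝ, ∀ᵐ ω ∂P, ∀ t : ℝ≥0, M t ω = jumpProcess γ F L t ω := by
  have hex : ∀ t : ℝ≥0, ∃ c : ℝ, ∀ ω, (t : ℝ≥0∞) < γ ω → M t ω = c := fun t => by
    by_cases h : ∃ ω, (t : ℝ≥0∞) < γ ω
    · obtain ⟨ω₀, h0⟩ := h
      exact ⟨M t ω₀, fun ω hω => eq_of_adapted hadp hω h0⟩
    · exact ⟨0, fun ω hω => absurd ⟨ω, hω⟩ h⟩
  choose F hF using hex
  refine ⟨F, ?_⟩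
  filter_upwards [hL] with ω hω t
  rcases le_or_gt (γ ω) t with h | h
  · rw [jumpProcess_of_le h, hω t h]
  · rw [jumpProcess_of_lt h, hF t ω h]

omit [IsProbabilityMeasure P] in
/-- A local martingale of the single jump filtration which is constant after the jump is a
martingale up to each time of the time set. -/
lemma IsLocalMartingale.condExp_eq (hγ : Measurable γ)
    (hM : IsLocalMartingale M (filtration γ) P) {L : Ω → ℝ}
    (hL : ∀ᵐ ω ∂P, ∀ t : ℝ≥0, γ ω ≤ (t : ℝ≥0∞) → M t ω = L ω)
    (ht : t ∈ timeSet (P.map γ)) (hst : s ≤ t) :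
    Integrable (M t) P ∧ P[M t | filtration γ s] =ᵐ[P] M s := by
  obtain ⟨τ, hτ, hmart⟩ := hM.localizing
  have hpos : 0 < P (γ ⁻¹' Ici (t : ℝ≥0∞)) := by
    rw [← Measure.map_apply hγ measurableSet_Ici]
    exact ht
  -- A single path fixes `n`: what `τ n` does there before `t` binds all paths that have not yet
  -- jumped.
  obtain ⟨ω₀, hω₀, n, hn⟩ : ∃ ω₀ ∈ γ ⁻¹' Ici (t : ℝ≥0∞), ∃ n, (t : WithTop ℝ≥0) < τ n ω₀ := by
    obtain ⟨ω₀, h1, h2⟩ := Measure.exists_mem_of_measure_ne_zero_of_ae hpos.ne'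
      (ae_restrict_of_ae hτ.tendsto_top)
    exact ⟨ω₀, h1, (h2.eventually (lt_mem_nhds (WithTop.coe_lt_top t))).exists⟩
  have hτlt : ∀ {ω : Ω} {u : ℝ≥0}, u < t → (u : ℝ≥0∞) < γ ω → (u : WithTop ℝ≥0) < τ n ω :=
    fun hut hu => lt_of_isStoppingTime (hτ.isStoppingTime n) hn.le hω₀ hut hu
  have key : ∀ v ≤ t, stoppedProcess M (τ n) v =ᵐ[P] M v := by
    intro v hv
    filter_upwards [hL] with ω hω
    rcases le_or_gt (v : WithTop ℝ≥0) (τ n ω) with h | h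
    · exact stoppedProcess_eq_of_le h
    · rw [stoppedProcess_eq_of_ge h.le]
      obtain ⟨u, hu⟩ : ∃ u : ℝ≥0, τ n ω = u :=
        ⟨_, (WithTop.coe_untop _ (ne_top_of_lt h)).symm⟩
      rw [hu] at h ⊢
      have huv : u < v := WithTop.coe_lt_coe.1 h
      have hγu : γ ω ≤ u := by
        by_contra hcon
        have := hτlt (huv.trans_le hv) (not_le.1 hcon)
        rw [hu] at this
        exact lt_irrefl _ this
      show M u ω = M v ω
      rw [hω u hγu, hω v (hγu.trans (ENNReal.coe_le_coe.2 huv.le))]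
  refine ⟨((hmart n).1.integrable t).congr (key t le_rfl), ?_⟩
  exact ((condExp_congr_ae (key t le_rfl)).symm.trans ((hmart n).1.condExp_ae_eq hst)).trans
    (key s hst)

theorem exists_conditionM_of_isLocalMartingale (hγ : Measurable γ) (hγ0 : 0 < P {ω | 0 < γ ω})
    (hM : IsLocalMartingale M (filtration γ) P) :
    ∃ (F H : ℝ≥0 → ℝ) (L' : Ω → ℝ), ConditionM (P.map γ) F H ∧ Measurable L' ∧
      (∀ t ∈ timeSet (P.map γ), IntegrableOn L' {ω | γ ω ≤ (t : ℝ≥0∞)} P) ∧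
      HasCondExp P (MeasurableSpace.comap γ inferInstance) L' (fun _ => 0) ∧
      ∀ᵐ ω ∂P, ∀ t : ℝ≥0,
        M t ω = jumpProcess γ F (fun ω' => H (γ ω').toNNReal + L' ω') t ω := by
  have := Measure.isProbabilityMeasure_map (μ := P) hγ.aemeasurable
  obtain ⟨L, hLm, hL⟩ := hM.exists_eq_of_le hγ
  obtain ⟨F, hF⟩ := exists_ae_eq_jumpProcess hM.adapted hL
  have hFt : ∀ t, M t =ᵐ[P] jumpProcess γ F L t := fun t => hF.mono fun ω hω => hω t
  have hmart := fun {s t : ℝ≥0} (ht : t ∈ timeSet (P.map γ)) (hst : s ≤ t) =>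
    hM.condExp_eq hγ hL ht hst
  have hLint : ∀ t ∈ timeSet (P.map γ), IntegrableOn L (γ ⁻¹' Iic (t : ℝ≥0∞)) P := by
    intro t ht
    refine (hmart ht le_rfl).1.integrableOn.congr_fun_ae ?_
    filter_upwards [ae_restrict_of_ae hL, ae_restrict_mem (hγ measurableSet_Iic)] with ω h1 h2
    exact h1 t h2
  obtain ⟨u, hu, huT, hcof⟩ := exists_monotone_cofinal_timeSet (zero_mem_timeSet hγ hγ0)
  set B : Set ℝ≥0∞ := ⋃ n, Iic (u n : ℝ≥0∞) with hB
  have hBm : MeasurableSet B := MeasurableSet.iUnion fun n => measurableSet_Iic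
  have hBae : ∀ᵐ ω ∂P, ∀ t : ℝ≥0, γ ω ≤ (t : ℝ≥0∞) → γ ω ∈ B := by
    filter_upwards [ae_measure_map_Ici_pos hγ] with ω hω t ht
    have hfin : γ ω ≠ ∞ := (ht.trans_lt ENNReal.coe_lt_top).ne
    obtain ⟨n, hn⟩ := (hcof _ (coe_mem_timeSet_of_le hω ENNReal.coe_toNNReal_le_self)).exists
    refine mem_iUnion.2 ⟨n, ?_⟩
    rw [mem_Iic, ← ENNReal.coe_toNNReal hfin]
    exact ENNReal.coe_le_coe.2 hn
  -- Adding `Bᶜ` makes the sets cover the space. `L` need not be integrable where `γ ∉ B`, so `L₁`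
  -- is set to zero there; almost surely `γ` is then infinite and `L` is not used.
  set S : ℕ → Set ℝ≥0∞ := fun n => Iic (u n : ℝ≥0∞) ∪ Bᶜ with hS
  have hSm : ∀ n, MeasurableSet (S n) := fun n => measurableSet_Iic.union hBm.compl
  have hSmono : Monotone S := fun i j hij =>
    union_subset_union_left _ (Iic_subset_Iic.2 (ENNReal.coe_le_coe.2 (hu hij)))
  have hScov : ⋃ n, S n = univ := by
    rw [hS, ← iUnion_union, ← hB, union_compl_self]
  set L₁ : Ω → ℝ := (γ ⁻¹' B).indicator L with hL₁
  have hL₁m : Measurable L₁ := hLm.indicator (hγ hBm)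
  have hL₁int : ∀ n, IntegrableOn L₁ (γ ⁻¹' S n) P := by
    intro n
    rw [hS]
    dsimp only
    rw [preimage_union]
    refine ((hLint _ (huT n)).indicator (hγ hBm)).union ?_
    refine integrableOn_zero.congr_fun (fun ω hω => ?_) (hγ hBm.compl)
    exact (indicator_of_notMem (show ω ∉ γ ⁻¹' B from hω) L).symm
  obtain ⟨h, hh, hhint, hhce⟩ := exists_generalized_condExp hγ hSm hSmono hL₁int
  set H : ℝ≥0 → ℝ := fun x => h x with hH
  set L' : Ω → ℝ := fun ω => L₁ ω - h (γ ω) with hL'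
  have hHm : Measurable H := hh.comp measurable_coe_nnreal_ennreal
  have hL'm : Measurable L' := hL₁m.sub (hh.comp hγ)
  have hL'S : ∀ n, IntegrableOn L' (γ ⁻¹' S n) P := fun n => (hL₁int n).sub (hhint n)
  have hsubS : ∀ t ∈ timeSet (P.map γ), ∃ n, γ ⁻¹' Iic (t : ℝ≥0∞) ⊆ γ ⁻¹' S n := by
    intro t ht
    obtain ⟨n, hn⟩ := (hcof t ht).exists
    exact ⟨n, preimage_mono ((Iic_subset_Iic.2 (ENNReal.coe_le_coe.2 hn)).trans
      subset_union_left)⟩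
  have hce : HasCondExp P (MeasurableSpace.comap γ inferInstance) L' (fun _ => 0) := by
    refine ⟨fun n => γ ⁻¹' S n, fun n => ⟨S n, hSm n, rfl⟩, fun i j hij =>
      preimage_mono (hSmono hij), ?_, fun n => ⟨hL'S n, ?_⟩⟩
    · rw [← preimage_iUnion, hScov, preimage_univ]
    · filter_upwards [hhce n] with ω hω
      rw [hω, Pi.zero_apply, indicator_zero]
  have hLint' : ∀ t ∈ timeSet (P.map γ), IntegrableOn L' (γ ⁻¹' Iic (t : ℝ≥0∞)) P := by
    intro t ht
    obtain ⟨n, hn⟩ := hsubS t ht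
    exact (hL'S n).mono_set hn
  have hHeq : ∀ {ω : Ω} {t : ℝ≥0}, γ ω ≤ (t : ℝ≥0∞) → H (γ ω).toNNReal = h (γ ω) := by
    intro ω t ht
    rw [hH]
    dsimp only
    rw [ENNReal.coe_toNNReal (ht.trans_lt ENNReal.coe_lt_top).ne]
  have hHP : ∀ t ∈ timeSet (P.map γ),
      IntegrableOn (fun ω => H (γ ω).toNNReal) (γ ⁻¹' Iic (t : ℝ≥0∞)) P := by
    intro t ht
    obtain ⟨n, hn⟩ := hsubS t ht
    exact ((hhint n).mono_set hn).congr_fun (fun ω hω => (hHeq hω).symm) (hγ measurableSet_Iic)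
  have hHi : MemL1loc (P.map γ) H := by
    refine ⟨hHm.comp measurable_subtype_coe, fun t ht => ?_⟩
    refine integrableOn_dG_map_of_measurable hγ measurableSet_Icc hHm ?_
    rw [image_coe_Icc_zero]
    exact hHP t ht
  have hLsplit : ∀ᵐ ω ∂P, ∀ t : ℝ≥0, γ ω ≤ (t : ℝ≥0∞) → L ω = H (γ ω).toNNReal + L' ω := by
    filter_upwards [hBae] with ω hω t ht
    rw [hHeq ht, hL', hL₁]
    dsimp only
    rw [indicator_of_mem (show ω ∈ γ ⁻¹' B from hω t ht), add_sub_cancel]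
  refine ⟨F, H, L', conditionM_of_main hHm hHi (Gbar_zero_pos hγ hγ0) fun t ht => ?_, hL'm,
    hLint', hce, ?_⟩
  -- The relation is the martingale property between `0` and `t`, integrated over `{γ > 0}`, an
  -- event of the σ-field at time `0`.
  · have h1 := setIntegral_preimage_Ioi (s := 0) hγ (hFt t) (hLint t ht) zero_le
    have h2 := setIntegral_preimage_Ioi (s := 0) hγ (hFt 0)
      (hLint 0 (mem_timeSet_of_le zero_le ht)) le_rfl
    rw [Ioc_self, preimage_empty, setIntegral_empty, add_zero] at h2
    have hpre : MeasurableSet[filtration γ 0] (γ ⁻¹' Ioi ((0 : ℝ≥0) : ℝ≥0∞)) := by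
      have := (measurableSet_filtration_le (t := 0) hγ le_rfl).compl
      convert this using 1
      ext ω
      simp [pos_iff_ne_zero]
    obtain ⟨hi, hce0⟩ := hmart ht (zero_le (a := t))
    have h3 := setIntegral_condExp ((filtration γ).le 0) hi hpre
    rw [setIntegral_congr_ae (hγ measurableSet_Ioi) (hce0.mono fun ω hω _ => hω), h2, h1] at h3
    rw [h3, setIntegral_dG_map hγ measurableSet_Ioc (hHi.integrableOn_Ioc ht), image_coe_Ioc]
    congr 1
    have hsub : γ ⁻¹' Ioc ((0 : ℝ≥0) : ℝ≥0∞) t ⊆ γ ⁻¹' Iic (t : ℝ≥0∞) :=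
      preimage_mono Ioc_subset_Iic_self
    have hi' := (hLint' t ht).mono_set hsub
    rw [setIntegral_congr_ae (g := fun ω => H (γ ω).toNNReal + L' ω) (hγ measurableSet_Ioc)
      (hLsplit.mono fun ω hω h => hω t h.2), integral_add ((hHP t ht).mono_set hsub) hi',
      setIntegral_eq_zero_of_hasCondExp hγ hce measurableSet_Ioc hi', add_zero]
  · filter_upwards [hF, hLsplit] with ω h1 h2 t
    rw [h1]
    rcases le_or_gt (γ ω) t with h | h
    · rw [jumpProcess_of_le h, jumpProcess_of_le h, h2 t h]
    · rw [jumpProcess_of_lt h, jumpProcess_of_lt h]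

end Necessity

end SingleJump

theorem theorem2 {Ω : Type*} [mΩ : MeasurableSpace Ω] (P : Measure Ω) [IsProbabilityMeasure P]
    (γ : Ω → ℝ≥0∞) (hγ : Measurable γ) (hγ0 : 0 < P {ω | 0 < γ ω})
    (M : ℝ≥0 → Ω → ℝ) (hM : Adapted (SingleJump.filtration γ) M)
    (hMr : ∀ᵐ ω ∂P, ∀ t : ℝ≥0, ContinuousWithinAt (fun s => M s ω) (Ici t) t) :
    SingleJump.IsLocalMartingale M (SingleJump.filtration γ) P ↔
      ∃ (F H : ℝ≥0 → ℝ) (L' : Ω → ℝ),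
        SingleJump.ConditionM (P.map γ) F H ∧
        Measurable L' ∧
        (∀ t ∈ SingleJump.timeSet (P.map γ), IntegrableOn L' {ω | γ ω ≤ (t : ℝ≥0∞)} P) ∧
        SingleJump.HasCondExp P (MeasurableSpace.comap γ inferInstance) L' (fun _ => 0) ∧
        ∀ᵐ ω ∂P, ∀ t : ℝ≥0,
          M t ω = SingleJump.jumpProcess γ F (fun ω' => H (γ ω').toNNReal + L' ω') t ω :=
  ⟨fun h => SingleJump.exists_conditionM_of_isLocalMartingale hγ hγ0 h,
    fun ⟨_, _, _, hF, _, hL', hL'0, hMe⟩ =>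
      SingleJump.isLocalMartingale_of_conditionM hγ hγ0 hM hMr hF hL' hL'0 hMe⟩
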